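/- All schemes, morphisms, isomorphisms and automorphisms are over $\mathbb{C}$. Let $Y$ be a projective conifold with exactly one singular point $p$, that is, an integral projective scheme over $\mathbb{C}$ with a closed point $p$ such that $Y\setminus\{p\}$ is smooth of dimension $3$ and $\widehat{\mathcal{O}}_{Y,p}\cong \mathbb{C}[[x,y,z,w]]/(xy-zw)$ as $\mathbb{C}$-algebras. Let $\pi:Y_0\to Y$ be the blow-up of $Y$ at $p$, with exceptional divisor $E=\pi^{-1}(p)\subset Y_0$. In $\mathbb{P}^4$ with homogeneous coordinates $[u:x:y:z:w]$ let $$D=V(u,\;u^2+xy-zw)\;\subset\; Y_1=V(u^2+xy-zw)\;\subset\;\mathbb{P}^4 ,$$ so that $Y_1$ is a smooth quadric threefold and $D\cong\mathbb{P}^1\times\mathbb{P}^1$ is a smooth hyperplane section of it. Fix an isomorphism $e:D\cong E$, so that $D$ is a divisor both in $Y_0$ and in $Y_1$. For an automorphism $\varphi$ of $D$, a gluing of $(Y_0,D)$ and $(Y_1,D)$ via $\varphi$ is a scheme $X$ that is a pushout $Y_0\cup_D Y_1$, in schemes over $\mathbb{C}$, of the closed immersions $\iota_E\circ e\circ\varphi:D\to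 Y_0$ and $\iota_D:D\to Y_1$, where $\iota_E:E\to Y_0$ and $\iota_D:D\to Y_1$ are the inclusions. **Lemma 1.3 (uniqueness of gluing).** For any two automorphisms $\varphi,\psi$ of $D$, every gluing $X$ of $(Y_0,D)$ and $(Y_1,D)$ via $\varphi$ and every gluing $X'$ via $\psi$ are isomorphic over $\mathbb{C}$. -/

import Mathlib

open CategoryTheory AlgebraicGeometry

noncomputable section

namespace ConifoldGluing

/-- The base scheme `Spec ℂ`. -/
abbrev SpecC : Scheme.{0} := Spec (CommRingCat.of ℂ)

/-- Schemes over `ℂ`, with morphisms over `ℂ`. -/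
abbrev CScheme : Type 1 := Over SpecC

/-! ### Projective space and its reduced closed subschemes -/

/-- The homogeneous coordinate ring `ℂ[X_0, …, X_n]` with its standard grading. -/
abbrev grading (n : ℕ) : ℕ → Submodule ℂ (MvPolynomial (Fin (n + 1)) ℂ) :=
  MvPolynomial.homogeneousSubmodule (Fin (n + 1)) ℂ

instance gradedAlgebra (n : ℕ) : GradedAlgebra (grading n) := MvPolynomial.gradedAlgebra

/-- Projective space `ℙⁿ` over `ℂ`. -/
def projSpace (n : ℕ) : CScheme :=
  Over.mk (Proj.toSpecZero (grading n) ≫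
    Spec.map (CommRingCat.ofHom (algebraMap ℂ (grading n 0))) : Proj (grading n) ⟶ SpecC)

/-- The closed subset of `ℙⁿ` where all polynomials in `s` vanish. -/
def zeros (n : ℕ) (s : Set (MvPolynomial (Fin (n + 1)) ℂ)) :
    TopologicalSpace.Closeds (projSpace n).left :=
  ⟨ProjectiveSpectrum.zeroLocus (grading n) s,
    ProjectiveSpectrum.isClosed_zeroLocus (grading n) s⟩

/-- The closed subset `V(s)` of `ℙⁿ` with its reduced scheme structure. When `s` generates a
prime ideal (as in the two cases used below) this is the subscheme of `ℙⁿ` defined by `s`. -/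
def projVariety (n : ℕ) (s : Set (MvPolynomial (Fin (n + 1)) ℂ)) : CScheme :=
  Over.mk ((Scheme.IdealSheafData.vanishingIdeal (zeros n s)).subschemeι ≫ (projSpace n).hom)

theorem zeros_anti (n : ℕ) {s t : Set (MvPolynomial (Fin (n + 1)) ℂ)} (h : s ⊆ t) :
    zeros n t ≤ zeros n s :=
  fun _ hx => Set.Subset.trans h hx

/-- The inclusion `V(t) ⟶ V(s)` for `s ⊆ t`. -/
def projInclusion (n : ℕ) {s t : Set (MvPolynomial (Fin (n + 1)) ℂ)} (h : s ⊆ t) :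
    projVariety n t ⟶ projVariety n s :=
  Over.homMk
    (Scheme.IdealSheafData.inclusion
      (Scheme.IdealSheafData.vanishingIdeal_antimono (zeros_anti n h)))
    (by simp [projVariety])

/-! ### The quadric pair `(Y₁, D)` -/

/-- The quadratic form `u² + xy - zw` in the homogeneous coordinates `[u : x : y : z : w]`. -/
def quadric : MvPolynomial (Fin (4 + 1)) ℂ :=
  .X 0 ^ 2 + .X 1 * .X 2 - .X 3 * .X 4

/-- The quadric threefold `Y₁ = V(u² + xy - zw)` in `ℙ⁴`. -/
def Y₁ : CScheme := projVariety 4 {quadric}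

/-- The quadric surface `D = V(u, u² + xy - zw)` in `ℙ⁴`. -/
def D : CScheme := projVariety 4 {.X 0, quadric}

/-- The inclusion of the hyperplane section `D` in `Y₁`. -/
def inclD : D ⟶ Y₁ := projInclusion 4 (by simp)

/-! ### Conifolds -/

/-- The ring homomorphism `ℂ → 𝒪_{Y,p}` given by the structure morphism of `Y`. -/
def stalkStructure (Y : CScheme) (p : Y.left) : ℂ →+* Y.left.presheaf.stalk p :=
  ((Scheme.ΓSpecIso (CommRingCat.of ℂ)).inv ≫ Y.hom.appTop ≫
    Y.left.presheaf.germ ⊤ p trivial).hom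

/-- The complete local ring `ℂ[[x, y, z, w]] / (xy - zw)`. -/
abbrev NodeRing : Type :=
  MvPowerSeries (Fin 4) ℂ ⧸ Ideal.span
    {(MvPowerSeries.X 0 * MvPowerSeries.X 1 - MvPowerSeries.X 2 * MvPowerSeries.X 3 :
      MvPowerSeries (Fin 4) ℂ)}

/-- `p` is a conifold singularity (a threefold ordinary double point) of `Y`: the completed
local ring at `p` is isomorphic, as a `ℂ`-algebra, to `ℂ[[x, y, z, w]] / (xy - zw)`. -/
def IsNode (Y : CScheme) (p : Y.left) : Prop :=
  ∃ e : AdicCompletion (IsLocalRing.maximalIdeal (Y.left.presheaf.stalk p))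
      (Y.left.presheaf.stalk p) ≃+* NodeRing,
    ∀ c : ℂ, e (algebraMap (Y.left.presheaf.stalk p) _ (stalkStructure Y p c)) =
      algebraMap ℂ NodeRing c

/-- `Y` is a projective conifold with `p` as its only singular point. -/
structure IsConifold (Y : CScheme) (p : Y.left) : Prop where
  projective : ∃ (n : ℕ) (i : Y ⟶ projSpace n), IsClosedImmersion i.left
  integral : IsIntegral Y.left
  closed : IsClosed ({p} : Set Y.left)
  smooth : SmoothOfRelativeDimension 3
    (Scheme.Opens.ι (X := Y.left) ⟨{p}ᶜ, closed.isOpen_compl⟩ ≫ Y.hom)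
  node : IsNode Y p

/-! ### Blow-ups -/

/-- The closed subscheme defined by `I` is an effective Cartier divisor: `I` is locally
generated by one nonzerodivisor. -/
def IsEffectiveCartier {X : Scheme.{0}} (I : X.IdealSheafData) : Prop :=
  ∀ x : X, ∃ U : X.affineOpens, x ∈ U.1 ∧
    ∃ f ∈ nonZeroDivisors Γ(X, U), I.ideal U = Ideal.span {f}

/-- `π : B ⟶ X` is the blow-up of `X` along the ideal sheaf `I`: the inverse image ideal of `I`
is an effective Cartier divisor, and `π` is universal with this property. -/
structure IsBlowup {B X : Scheme.{0}} (π : B ⟶ X) (I : X.IdealSheafData) : Prop where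
  cartier : IsEffectiveCartier (I.comap π)
  lift : ∀ (T : Scheme.{0}) (f : T ⟶ X), IsEffectiveCartier (I.comap f) →
    ∃! g : T ⟶ B, g ≫ π = f

/-- The ideal sheaf of the reduced closed subscheme supported on the closure of `p`
(that is, on `p` itself if `p` is a closed point). -/
def pointIdeal {X : Scheme.{0}} (p : X) : X.IdealSheafData :=
  Scheme.IdealSheafData.vanishingIdeal ⟨closure {p}, isClosed_closure⟩

/-- The exceptional divisor of `π : Y₀ ⟶ Y` over `p`: the scheme-theoretic preimage of `p`. -/
def exceptional {Y₀ Y : CScheme} (π : Y₀ ⟶ Y) (p : Y.left) : CScheme :=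
  Over.mk (((pointIdeal p).comap π.left).subschemeι ≫ Y₀.hom)

/-- The inclusion of the exceptional divisor in `Y₀`. -/
def inclE {Y₀ Y : CScheme} (π : Y₀ ⟶ Y) (p : Y.left) : exceptional π p ⟶ Y₀ :=
  Over.homMk ((pointIdeal p).comap π.left).subschemeι rfl

/-! ### Gluing -/

/-- `X` is a gluing of `A` and `B` along the morphisms `i : Z ⟶ A` and `j : Z ⟶ B`
(closed immersions in the application): it is a pushout `A ∪_Z B` in schemes over `ℂ`. -/
def IsGluing {Z A B : CScheme} (i : Z ⟶ A) (j : Z ⟶ B) (X : CScheme) : Prop :=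
  ∃ (a : A ⟶ X) (b : B ⟶ X), IsPushout i j a b

end ConifoldGluing

end

/-!
The exceptional divisor, the conifold and the blow-up enter only through a morphism
`D ⟶ Y₀`: the point is that every automorphism `χ` of the quadric surface `D` extends to an
automorphism `Φ` of the quadric threefold `Y₁` (`exists_extension`). If `χ` is `φ` followed by the
inverse of `ψ`, then the pair consisting of the identity of `Y₀` and of `Φ` identifies the two
gluing data, and therefore their pushouts (`IsPushout.nonempty_iso`).

Geometrically, `D ≅ ℙ¹ × ℙ¹` by the Segre map `(a, b), (p, q) ↦ [0 : ap : bq : aq : bp]`, and an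
automorphism of `ℙ¹ × ℙ¹` consists of two projectivities of `ℙ¹`, possibly followed by the
exchange of the factors. Writing the coordinates `x, y, z, w` as a matrix `M = [[x, z], [w, y]]`
with determinant `xy - zw`, the pair of projectivities acts by `M ↦ G M Hᵀ`. Over `ℂ` one can
normalize `det G * det H = 1`, so that this linear map, together with the identity on the
coordinate `u`, preserves `u² + xy - zw`. The exchange of the factors is the exchange of `z` and
`w`.

The classification of the automorphisms of `D` is done with polynomials:

* A morphism from a closed subscheme of `ℙⁿ` to `ℙᵐ` is given near each closed point by
  homogeneous polynomials (`exists_local_formula`), and a morphism on a reduced closed subscheme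
  is determined by its effect on closed points (`hom_ext_pt`).
* Pull back local formulas for `χ` to the ring of polynomials in `a, b, p, q` and remove their
  common factors. As this ring is factorial, the result is one formula that holds everywhere, and
  as its values satisfy `xy = zw`, it comes from two pairs of bihomogeneous polynomials
  (`exists_global_formula`).
* The bidegrees of the two pairs form a `2 × 2` matrix of natural numbers. The composition with
  the corresponding formula for `χ⁻¹` is the identity, and a form without zeros on `ℙ¹ × ℙ¹` is
  constant, so that the matrices of `χ` and `χ⁻¹` are inverse to each other
  (`bidegree_of_inverse`). Hence they are permutation matrices, and the polynomials are linear
  forms (`exists_linearEquiv_of_bidegree`).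
-/

noncomputable section

namespace ConifoldGluing

open MvPolynomial

/-! ### Closed points of projective space -/

section Proj

variable {n : ℕ}

/-- The action of the one-parameter torus with weights `w` on a weighted homogeneous polynomial. -/
theorem _root_.MvPolynomial.IsWeightedHomogeneous.aeval_mul_pow {σ A : Type*}
    [CommRing A] [Algebra ℂ A] [Fintype σ] {w : σ → ℕ} {f : MvPolynomial σ ℂ} {d : ℕ}
    (hf : IsWeightedHomogeneous w f d) (v : σ → A) (t : A) :
    aeval (fun i => v i * t ^ w i) f = aeval v f * t ^ d := by
  rw [aeval_eq_eval₂Hom, aeval_eq_eval₂Hom, coe_eval₂Hom, coe_eval₂Hom, eval₂_eq', eval₂_eq',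
    Finset.sum_mul]
  refine Finset.sum_congr rfl fun s hs => ?_
  have hd : ∑ i, w i * s i = d := by
    rw [← hf (mem_support_iff.mp hs), Finsupp.weight_apply, Finsupp.sum_fintype] <;>
      simp [mul_comm]
  simp_rw [mul_pow, ← pow_mul, Finset.prod_mul_distrib, Finset.prod_pow_eq_pow_sum, hd, mul_assoc]

theorem _root_.MvPolynomial.IsHomogeneous.aeval_mul_pow {σ A : Type*} [CommRing A]
    [Algebra ℂ A] [Fintype σ] {f : MvPolynomial σ ℂ} {d : ℕ} (hf : f.IsHomogeneous d)
    (v : σ → A) (t : A) :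
    aeval (fun i => v i * t) f = aeval v f * t ^ d := by
  rw [← IsWeightedHomogeneous.aeval_mul_pow hf]
  simp

/-- Restriction of a polynomial to the line through `v`, as a polynomial in the parameter. -/
def lineRestriction (v : Fin (n + 1) → ℂ) : MvPolynomial (Fin (n + 1)) ℂ →ₐ[ℂ] Polynomial ℂ :=
  aeval fun i => Polynomial.C (v i) * Polynomial.X

theorem lineRestriction_of_isHomogeneous (v : Fin (n + 1) → ℂ) {f : MvPolynomial (Fin (n + 1)) ℂ}
    {d : ℕ} (hf : f.IsHomogeneous d) :
    lineRestriction v f = Polynomial.C (eval v f) * Polynomial.X ^ d := by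
  rw [lineRestriction, hf.aeval_mul_pow (fun i => Polynomial.C (v i))]
  congr 1
  exact (comp_aeval_apply v (Polynomial.CAlgHom (R := ℂ)) f).symm

theorem coeff_lineRestriction (v : Fin (n + 1) → ℂ) (f : MvPolynomial (Fin (n + 1)) ℂ) (k : ℕ) :
    (lineRestriction v f).coeff k = eval v (homogeneousComponent k f) := by
  conv_lhs => rw [← sum_homogeneousComponent f]
  simp_rw [map_sum, Polynomial.finsetSum_coeff,
    lineRestriction_of_isHomogeneous v (homogeneousComponent_isHomogeneous _ f),
    Polynomial.coeff_C_mul_X_pow]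
  rw [Finset.sum_ite_eq]
  split_ifs with h
  · rfl
  · rw [homogeneousComponent_eq_zero, map_zero]
    simpa using h

/-- The closed point `[v]` of projective space: the homogeneous prime ideal of the polynomials that
vanish on the line through `v`. -/
def pt (v : Fin (n + 1) → ℂ) (hv : v ≠ 0) : Proj (grading n) where
  asHomogeneousIdeal :=
    { toSubmodule := RingHom.ker (lineRestriction v)
      is_homogeneous' := by
        intro i f hf
        have hf' : lineRestriction v f = 0 := hf
        change lineRestriction v _ = 0
        have : ((DirectSum.decompose (grading n) f) i : MvPolynomial (Fin (n + 1)) ℂ) =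
            homogeneousComponent i f := by
          exact MvPolynomial.decomposition.decompose'_apply f i
        rw [this, lineRestriction_of_isHomogeneous v (homogeneousComponent_isHomogeneous _ f),
          ← coeff_lineRestriction, hf']
        simp }
  isPrime := RingHom.ker_isPrime (lineRestriction v).toRingHom
  not_irrelevant_le := by
    intro h
    apply hv
    funext i
    have hX : (X i : MvPolynomial (Fin (n + 1)) ℂ) ∈ HomogeneousIdeal.irrelevant (grading n) := by
      rw [HomogeneousIdeal.mem_irrelevant_iff, GradedRing.proj_apply,
        DirectSum.decompose_of_mem_ne (grading n) (isHomogeneous_X ℂ i) one_ne_zero]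
    have h2 : lineRestriction v (X i) = 0 := h hX
    rw [lineRestriction_of_isHomogeneous v (isHomogeneous_X ℂ i), eval_X] at h2
    simpa using h2

theorem mem_pt {v : Fin (n + 1) → ℂ} (hv : v ≠ 0) {f : MvPolynomial (Fin (n + 1)) ℂ} {d : ℕ}
    (hf : f.IsHomogeneous d) : f ∈ (pt v hv).asHomogeneousIdeal ↔ eval v f = 0 := by
  change lineRestriction v f = 0 ↔ _
  rw [lineRestriction_of_isHomogeneous v hf]
  simp

/-- Homogeneous ideals are determined by their homogeneous elements. -/
theorem homogeneousIdeal_ext {I J : HomogeneousIdeal (grading n)}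
    (h : ∀ (d : ℕ) (f : MvPolynomial (Fin (n + 1)) ℂ), f.IsHomogeneous d → (f ∈ I ↔ f ∈ J)) :
    I = J := by
  have key : ∀ (I : HomogeneousIdeal (grading n)) f,
      f ∈ I ↔ ∀ i, homogeneousComponent i f ∈ I := by
    intro I f
    rw [← HomogeneousIdeal.mem_iff, I.isHomogeneous.mem_iff]
    refine forall_congr' fun i => ?_
    rw [← HomogeneousIdeal.mem_iff]
    exact iff_of_eq (congrArg (· ∈ I.toIdeal) (MvPolynomial.decomposition.decompose'_apply f i))
  ext f
  change f ∈ I ↔ f ∈ J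
  rw [key I, key J]
  exact forall_congr' fun i => h i _ (homogeneousComponent_isHomogeneous i f)

/-- The homogeneous coordinates have no common zero. -/
theorem exists_X_notMem (p : Proj (grading n)) :
    ∃ j, (X j : MvPolynomial (Fin (n + 1)) ℂ) ∉ p.asHomogeneousIdeal := by
  by_contra! h
  apply p.not_irrelevant_le
  intro f hf
  have hf0 : constantCoeff f = 0 := by
    rw [HomogeneousIdeal.mem_irrelevant_iff, GradedRing.proj_apply] at hf
    have h0 : homogeneousComponent 0 f = 0 :=
      (MvPolynomial.decomposition.decompose'_apply f 0).symm.trans hf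
    rw [homogeneousComponent_zero] at h0
    exact C_injective _ _ (by rw [constantCoeff_eq, h0, map_zero])
  have : f ∈ Ideal.span (Set.range (X : Fin (n + 1) → MvPolynomial (Fin (n + 1)) ℂ)) := by
    rw [← Set.image_univ, mem_ideal_span_X_image]
    intro m hm
    by_contra! hm'
    have : m = 0 := by ext i; exact hm' i (Set.mem_univ i)
    subst this
    exact (mem_support_iff.mp hm) hf0
  exact (Ideal.span_le.mpr (by rintro _ ⟨j, rfl⟩; exact h j)) this

/-- A point of `ℙⁿ` on which the coordinates are proportional to `v` is the point `[v]`. -/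
theorem eq_pt {p : Proj (grading n)} {v : Fin (n + 1) → ℂ} (hv : v ≠ 0) {j : Fin (n + 1)}
    (hj : v j ≠ 0) (h : ∀ i, C (v j) * X i - C (v i) * X j ∈ p.asHomogeneousIdeal) :
    p = pt v hv := by
  have hC : ∀ c : ℂ, c ≠ 0 → ∀ f : MvPolynomial (Fin (n + 1)) ℂ,
      C c * f ∈ p.asHomogeneousIdeal → f ∈ p.asHomogeneousIdeal := by
    intro c hc f hf
    have := p.asHomogeneousIdeal.toIdeal.mul_mem_left (C c⁻¹) hf
    rwa [← mul_assoc, ← C_mul, inv_mul_cancel₀ hc, C_1, one_mul] at this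
  have hXj : (X j : MvPolynomial (Fin (n + 1)) ℂ) ∉ p.asHomogeneousIdeal := by
    intro hXj
    obtain ⟨i, hi⟩ := exists_X_notMem p
    apply hi
    apply hC _ hj
    have := p.asHomogeneousIdeal.toIdeal.add_mem (h i)
      (p.asHomogeneousIdeal.toIdeal.mul_mem_left (C (v i)) hXj)
    rwa [sub_add_cancel] at this
  have key : ∀ (d : ℕ) (f : MvPolynomial (Fin (n + 1)) ℂ), f.IsHomogeneous d →
      C (v j ^ d) * f - C (eval v f) * X j ^ d ∈ p.asHomogeneousIdeal := by
    intro d f hf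
    let q := Ideal.Quotient.mkₐ ℂ p.asHomogeneousIdeal.toIdeal
    have hq : ∀ i, q (C (v j)) * q (X i) = q (C (v i)) * q (X j) := by
      intro i
      rw [← map_mul, ← map_mul]
      exact Ideal.Quotient.eq.mpr (h i)
    refine Ideal.Quotient.eq.mp (?_ : q _ = q _)
    have h1 : ∀ (g : MvPolynomial (Fin (n + 1)) ℂ),
        q g = eval₂ (q.toRingHom.comp C) (fun i => q (X i)) g := by
      intro g
      conv_lhs => rw [← eval₂_eta g]
      exact eval₂_comp_left q.toRingHom C X g
    rw [map_mul, map_mul, h1 f, eval₂_eq', eval_eq', map_sum, map_sum, Finset.sum_mul,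
      Finset.mul_sum]
    refine Finset.sum_congr rfl fun s hs => ?_
    have hd : ∑ i, s i = d := by
      rw [← hf (mem_support_iff.mp hs), Finsupp.weight_apply, Finsupp.sum_fintype] <;> simp
    rw [← hd, ← Finset.prod_pow_eq_pow_sum, ← Finset.prod_pow_eq_pow_sum, C_mul, map_mul,
      mul_left_comm, map_prod C, map_prod C, map_prod q, map_prod q, map_prod q,
      ← Finset.prod_mul_distrib, mul_assoc, ← Finset.prod_mul_distrib]
    congr 1
    refine Finset.prod_congr rfl fun i _ => ?_
    rw [C_pow, C_pow, map_pow, map_pow, map_pow, ← mul_pow, ← mul_pow, hq]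
  refine ProjectiveSpectrum.ext (homogeneousIdeal_ext fun d f hf => ?_)
  rw [mem_pt hv hf]
  have k := key d f hf
  constructor
  · intro hfp
    by_contra hne
    have := p.asHomogeneousIdeal.toIdeal.sub_mem
      (p.asHomogeneousIdeal.toIdeal.mul_mem_left (C (v j ^ d)) hfp) k
    rw [sub_sub_cancel] at this
    exact hXj (p.isPrime.mem_of_pow_mem _ (hC _ hne _ this))
  · intro hf0
    rw [hf0, C_0, zero_mul, sub_zero] at k
    exact hC _ (pow_ne_zero _ hj) _ k

theorem isHomogeneous_linear (v : Fin (n + 1) → ℂ) (i j : Fin (n + 1)) :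
    (C (v j) * X i - C (v i) * X j : MvPolynomial (Fin (n + 1)) ℂ).IsHomogeneous 1 := by
  exact IsHomogeneous.sub ((isHomogeneous_C _ _).mul (isHomogeneous_X ℂ _))
    ((isHomogeneous_C _ _).mul (isHomogeneous_X ℂ _))

theorem pt_eq_pt_iff {v w : Fin (n + 1) → ℂ} (hv : v ≠ 0) (hw : w ≠ 0) :
    pt v hv = pt w hw ↔ ∀ i j, v i * w j = v j * w i := by
  constructor
  · intro h i j
    have h1 : C (w j) * X i - C (w i) * X j ∈ (pt v hv).asHomogeneousIdeal := by
      rw [h, mem_pt hw (isHomogeneous_linear w i j)]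
      simp [mul_comm]
    rw [mem_pt hv (isHomogeneous_linear w i j)] at h1
    simp only [eval_sub, eval_mul, eval_C, eval_X] at h1
    linear_combination h1
  · intro h
    obtain ⟨j, hj⟩ := Function.ne_iff.mp hw
    refine eq_pt hw hj fun i => ?_
    rw [mem_pt hv (isHomogeneous_linear w i j)]
    simp only [eval_sub, eval_mul, eval_C, eval_X]
    linear_combination h i j

theorem pt_smul {v : Fin (n + 1) → ℂ} (hv : v ≠ 0) {c : ℂ} (hcv : c • v ≠ 0) :
    pt (c • v) hcv = pt v hv := by
  rw [pt_eq_pt_iff]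
  intro i j
  simp only [Pi.smul_apply, smul_eq_mul]
  ring

/-! ### Functions on projective space and local formulas for morphisms -/

theorem le_preimage_top {X Y : Scheme.{0}} (f : X ⟶ Y) (U : X.Opens) : U ≤ f ⁻¹ᵁ ⊤ := le_top

/-- The constant functions on an open subset `U` of a scheme over `ℂ`, as a ring homomorphism
`ℂ → Γ(X, U)`. -/
def const {X : Scheme.{0}} (f : X ⟶ SpecC) (U : X.Opens) : CommRingCat.of ℂ ⟶ Γ(X, U) :=
  (Scheme.ΓSpecIso (CommRingCat.of ℂ)).inv ≫ f.appLE ⊤ U (le_preimage_top f U)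

theorem const_comp_app {X Z : Scheme.{0}} (f : X ⟶ SpecC) (g : Z ⟶ X) (U : X.Opens) :
    const f U ≫ g.app U = const (g ≫ f) (g ⁻¹ᵁ U) := by
  simp [const, Scheme.Hom.app_eq_appLE, Scheme.Hom.appLE_comp_appLE]

theorem const_comp_map {X : Scheme.{0}} (f : X ⟶ SpecC) {U V : X.Opens} (h : V ≤ U) :
    const f U ≫ X.presheaf.map (homOfLE h).op = const f V := by
  simp [const]

theorem toSpecΓ_SpecMap_const {X : Scheme.{0}} (f : X ⟶ SpecC) (U : X.Opens) :
    U.toSpecΓ ≫ Spec.map (const f U) = U.ι ≫ f := by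
  rw [const, Spec.map_comp, ← Category.assoc, Scheme.Opens.toSpecΓ_SpecMap_appLE, Category.assoc]
  have h : (⊤ : (Spec (CommRingCat.of ℂ)).Opens).toSpecΓ =
      (⊤ : (Spec (CommRingCat.of ℂ)).Opens).ι ≫ (Spec (CommRingCat.of ℂ)).toSpecΓ := by
    rw [Scheme.Opens.toSpecΓ_top]
  rw [h, Category.assoc, toSpecΓ_SpecMap_ΓSpecIso_inv, Category.comp_id]
  simp

/-- Ring homomorphisms into `Γ(X, U)` are determined by the morphisms from `U` that they induce. -/
theorem eq_of_toSpecΓ_comp {X : Scheme.{0}} {R : CommRingCat.{0}} {U : X.Opens} {a b : R ⟶ Γ(X, U)}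
    (h : U.toSpecΓ ≫ Spec.map a = U.toSpecΓ ≫ Spec.map b) : a = b := by
  have h2 := congrArg (fun g : U.toScheme ⟶ Spec R => (Scheme.ΓSpecIso R).inv ≫ g.appTop) h
  simp only [Scheme.Hom.comp_appTop, Scheme.Opens.toSpecΓ_appTop,
    ← Scheme.ΓSpecIso_inv_naturality_assoc, Iso.inv_hom_id_assoc] at h2
  exact (cancel_mono U.topIso.inv).mp h2

/-- The Nullstellensatz: at a closed point, every function has a value in `ℂ`. -/
theorem exists_evaluation_eq {X : Scheme.{0}} (f : X ⟶ SpecC) [LocallyOfFiniteType f] {x : X}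
    (hx : IsClosed ({x} : Set X)) {U : X.Opens} (hU : x ∈ U) (s : Γ(X, U)) :
    ∃ c : ℂ, X.evaluation U x hU s = X.evaluation U x hU (const f U c) := by
  have h1 : const f U ≫ X.evaluation U x hU = (residueFieldIsoBase f x hx).inv := by
    apply Spec.map_injective
    rw [SpecMap_residueFieldIsoBase_inv, ← Scheme.germ_residue, ← Category.assoc, Spec.map_comp,
      Spec.map_comp, ← Scheme.Opens.fromSpecStalkOfMem_toSpecΓ, Category.assoc,
      toSpecΓ_SpecMap_const, Scheme.Opens.fromSpecStalkOfMem_ι_assoc, Scheme.fromSpecResidueField,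
      Category.assoc]
  obtain ⟨c, hc⟩ : ∃ c : ℂ, (residueFieldIsoBase f x hx).inv c = X.evaluation U x hU s :=
    (ConcreteCategory.bijective_of_isIso (residueFieldIsoBase f x hx).inv).2 _
  refine ⟨c, ?_⟩
  rw [← hc, ← h1]
  rfl

/-- The structure morphism of projective space, with source written as `Proj (grading n)`. -/
def structP (n : ℕ) : Proj (grading n) ⟶ SpecC := (projSpace n).hom

theorem bijective_algebraMap_zero (n : ℕ) : Function.Bijective (algebraMap ℂ (grading n 0)) := by
  constructor
  · intro a b h
    exact C_injective _ _ (congrArg Subtype.val h)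
  · rintro ⟨f, hf⟩
    refine ⟨constantCoeff f, Subtype.ext ?_⟩
    have : f = homogeneousComponent 0 f := by
      rw [homogeneousComponent_of_mem hf, if_pos rfl]
    rw [homogeneousComponent_zero] at this
    exact this.symm

instance : IsIso (CommRingCat.ofHom (algebraMap ℂ (grading n 0))) :=
  (ConcreteCategory.isIso_iff_bijective _).mpr (bijective_algebraMap_zero n)

instance : Algebra.FiniteType (grading n 0) (MvPolynomial (Fin (n + 1)) ℂ) :=
  have : IsScalarTower ℂ (grading n 0) (MvPolynomial (Fin (n + 1)) ℂ) :=
    ⟨fun a b c => smul_mul_assoc a (b : MvPolynomial (Fin (n + 1)) ℂ) c⟩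
  Algebra.FiniteType.of_restrictScalars_finiteType ℂ _ _

instance : LocallyOfFiniteType (structP n) := by
  delta structP projSpace
  dsimp only [Over.mk_hom]
  infer_instance

instance : IsSeparated (structP n) := by
  delta structP projSpace
  dsimp only [Over.mk_hom]
  infer_instance

/-- The constant functions on the basic open set `D₊(g)` of `ℙⁿ`, as elements of the homogeneous
localization at `g`. -/
theorem const_structP (g : MvPolynomial (Fin (n + 1)) ℂ) :
    const (structP n) (Proj.basicOpen (grading n) g) =
      CommRingCat.ofHom ((HomogeneousLocalization.fromZeroRingHom (grading n)
        (Submonoid.powers g)).comp (algebraMap ℂ (grading n 0))) ≫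
      Proj.awayToSection (grading n) g := by
  apply eq_of_toSpecΓ_comp
  have hι : (Proj.basicOpen (grading n) g).ι ≫ Proj.toSpecZero (grading n) =
      Proj.basicOpenToSpec (grading n) g ≫ Spec.map (CommRingCat.ofHom
        (HomogeneousLocalization.fromZeroRingHom (grading n) (Submonoid.powers g))) := by
    have h1 (U) (e : U = ⊤) : (Proj.basicOpen (grading n) g).ι ≫ (Scheme.topIso _).inv ≫
        (Scheme.isoOfEq _ e).inv = Scheme.homOfLE _ (le_top.trans_eq e.symm) := by
      simp only [← Category.assoc, Iso.comp_inv_eq]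
      simp only [Scheme.topIso_hom, Category.assoc, Scheme.isoOfEq_hom_ι, Scheme.homOfLE_ι]
    rw [Proj.toSpecZero, reassoc_of% h1, Proj.basicOpenToSpec, Category.assoc,
      ← Scheme.Opens.toSpecΓ_SpecMap_presheaf_map_assoc, Proj.basicOpenToSpec, Category.assoc,
      ← Spec.map_comp, ← Spec.map_comp, ← Spec.map_comp]
    rfl
  rw [toSpecΓ_SpecMap_const, CommRingCat.ofHom_comp, Category.assoc, Spec.map_comp, Spec.map_comp,
    ← Category.assoc, ← Category.assoc]
  change _ ≫ Proj.toSpecZero (grading n) ≫ _ = _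
  rw [← Category.assoc, hι]
  rfl

/-- A homogeneous fraction with denominator a power of `g` is invertible in the homogeneous
localization at a prime `p ∌ g` if and only if its numerator is not in `p`. -/
theorem isUnit_mapId_mk_iff {g : MvPolynomial (Fin (n + 1)) ℂ} {p : ProjectiveSpectrum (grading n)}
    (hp : g ∈ p.asHomogeneousIdeal.toIdeal.primeCompl)
    (z : HomogeneousLocalization.NumDenSameDeg (grading n) (Submonoid.powers g)) :
    IsUnit (HomogeneousLocalization.mapId (grading n) (Submonoid.powers_le.mpr hp)
      (HomogeneousLocalization.mk z)) ↔
      (z.num : MvPolynomial (Fin (n + 1)) ℂ) ∉ p.asHomogeneousIdeal := by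
  let z' : HomogeneousLocalization.NumDenSameDeg (grading n)
      p.asHomogeneousIdeal.toIdeal.primeCompl :=
    ⟨z.deg, z.num, z.den, Submonoid.powers_le.mpr hp z.den_mem⟩
  change IsUnit (HomogeneousLocalization.mk z' :
    HomogeneousLocalization.AtPrime (grading n) p.asHomogeneousIdeal.toIdeal) ↔ _
  rw [← HomogeneousLocalization.isUnit_iff_isUnit_val, HomogeneousLocalization.val_mk,
    Localization.mk_eq_mk', IsLocalization.AtPrime.isUnit_mk'_iff]
  rfl

theorem evaluation_awayToSection_eq_zero_iff {g : MvPolynomial (Fin (n + 1)) ℂ}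
    {p : Proj (grading n)} (hp : p ∈ Proj.basicOpen (grading n) g)
    (z : HomogeneousLocalization.NumDenSameDeg (grading n) (Submonoid.powers g)) :
    (Proj (grading n)).evaluation _ p hp
      (Proj.awayToSection (grading n) g (HomogeneousLocalization.mk z)) = 0 ↔
      (z.num : MvPolynomial (Fin (n + 1)) ℂ) ∈ p.asHomogeneousIdeal := by
  rw [Scheme.evaluation_eq_zero_iff_notMem_basicOpen, Scheme.mem_basicOpen _ _ _ hp]
  have h := congr($(ProjectiveSpectrum.Proj.awayToSection_germ (grading n) g p hp)
    (HomogeneousLocalization.mk z))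
  have h' : ((Proj (grading n)).presheaf.germ _ p hp)
      (Proj.awayToSection (grading n) g (HomogeneousLocalization.mk z)) =
      (Proj.stalkIso' (grading n) p).symm
        (HomogeneousLocalization.mapId (grading n) (Submonoid.powers_le.mpr hp)
          (HomogeneousLocalization.mk z)) := h
  rw [h']
  have h2 : ∀ y, IsUnit ((Proj.stalkIso' (grading n) p).symm y) ↔ IsUnit y :=
    fun y => MulEquiv.isUnit_map (Proj.stalkIso' (grading n) p).symm
  refine (not_congr (h2 _)).trans ?_
  rw [isUnit_mapId_mk_iff hp z]
  exact not_not

/-- The function `a / g ^ k` on `D₊(g)` takes the value `c` at the point `p` if and only if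
`a - c * g ^ k` belongs to the ideal of `p`. -/
theorem evaluation_awayMk_eq_const_iff {g a : MvPolynomial (Fin (n + 1)) ℂ} {d k : ℕ}
    (hg : g ∈ grading n d) (ha : a ∈ grading n (k • d)) {p : Proj (grading n)}
    (hp : p ∈ Proj.basicOpen (grading n) g) (c : ℂ) :
    (Proj (grading n)).evaluation _ p hp
      (Proj.awayToSection (grading n) g (HomogeneousLocalization.Away.mk (grading n) hg k a ha)) =
      (Proj (grading n)).evaluation _ p hp (const (structP n) _ c) ↔
      a - C c * g ^ k ∈ p.asHomogeneousIdeal := by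
  have hgk : g ^ k ∈ grading n (k • d) := SetLike.pow_mem_graded k hg
  have hgk' : g ^ k ∈ Submonoid.powers g := ⟨k, rfl⟩
  have hc : a - C c * g ^ k ∈ grading n (k • d) := by
    refine Submodule.sub_mem _ ha ?_
    rw [← smul_eq_C_mul]
    exact Submodule.smul_mem _ _ hgk
  have hz := evaluation_awayToSection_eq_zero_iff hp
    { deg := k • d, num := ⟨_, hc⟩, den := ⟨_, hgk⟩, den_mem := hgk' }
  rw [← hz, ← sub_eq_zero, ← map_sub, const_structP, CommRingCat.comp_apply, ← map_sub]
  have : HomogeneousLocalization.Away.mk (grading n) hg k a ha -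
      CommRingCat.ofHom ((HomogeneousLocalization.fromZeroRingHom (grading n)
        (Submonoid.powers g)).comp (algebraMap ℂ (grading n 0))) c =
      HomogeneousLocalization.mk
        { deg := k • d, num := ⟨_, hc⟩, den := ⟨_, hgk⟩, den_mem := hgk' } := by
    apply HomogeneousLocalization.val_injective
    rw [HomogeneousLocalization.val_sub, HomogeneousLocalization.Away.val_mk,
      HomogeneousLocalization.val_mk]
    change _ - Localization.mk (C c) 1 = _
    rw [Localization.sub_mk]
    congr 1
    · rw [Submonoid.coe_one, one_mul, mul_comm]
    · exact mul_one _
  rw [this]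

theorem const_comp_appLE {X Z : Scheme.{0}} (f : X ⟶ SpecC) (g : Z ⟶ X) (U : X.Opens) (W : Z.Opens)
    (h : W ≤ g ⁻¹ᵁ U) : const f U ≫ g.appLE U W h = const (g ≫ f) W := by
  rw [Scheme.Hom.appLE, ← Category.assoc, const_comp_app, const_comp_map]

/-- Two functions on `X` agree at `f z` if and only if their pullbacks under `f` agree at `z`. -/
theorem evaluation_appLE_eq_iff {X Z : Scheme.{0}} (f : Z ⟶ X) {U : X.Opens} {W : Z.Opens}
    (h : W ≤ f ⁻¹ᵁ U) {z : Z} (hz : z ∈ W) (s t : Γ(X, U)) :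
    Z.evaluation W z hz (f.appLE U W h s) = Z.evaluation W z hz (f.appLE U W h t) ↔
      X.evaluation U (f z) (h hz) s = X.evaluation U (f z) (h hz) t := by
  have key : ∀ s, Z.evaluation W z hz (f.appLE U W h s) =
      f.residueFieldMap z (X.evaluation U (f z) (h hz) s) := by
    intro s
    refine Eq.trans ?_ (Scheme.evaluation_naturality_apply f z (h hz) s).symm
    rw [← CommRingCat.comp_apply, ← CommRingCat.comp_apply, Scheme.Hom.appLE,
      ← Scheme.germ_residue, ← Scheme.germ_residue, Category.assoc,
      Z.presheaf.germ_res_assoc (homOfLE h) z hz]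
  rw [key, key]
  exact (RingHom.injective _).eq_iff

theorem exists_isHomogeneous_basicOpen {p : Proj (grading n)} {O : (Proj (grading n)).Opens}
    (hp : p ∈ O) : ∃ (d : ℕ) (g : MvPolynomial (Fin (n + 1)) ℂ), 0 < d ∧ g.IsHomogeneous d ∧
      p ∈ Proj.basicOpen (grading n) g ∧ Proj.basicOpen (grading n) g ≤ O := by
  obtain ⟨_, ⟨_, ⟨g, rfl⟩, rfl⟩, hpg, hgO⟩ :=
    (Proj.isBasis_basicOpen (grading n)).exists_subset_of_mem_open hp O.isOpen
  have hpg' := hpg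
  rw [Proj.basicOpen_eq_iSup_proj] at hpg'
  obtain ⟨i, hi⟩ := TopologicalSpace.Opens.mem_iSup.mp hpg'
  obtain ⟨k, hk⟩ := exists_X_notMem p
  have hg : (GradedRing.proj (grading n) i g).IsHomogeneous i := by
    rw [GradedRing.proj_apply]
    exact (DirectSum.decompose (grading n) g i).2
  refine ⟨i + 1, GradedRing.proj (grading n) i g * X k, i.succ_pos, hg.mul (isHomogeneous_X ℂ k),
    ?_, ?_⟩
  · rw [Proj.basicOpen_mul]
    exact ⟨hi, hk⟩
  · rw [Proj.basicOpen_mul]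
    refine le_trans inf_le_left (le_trans ?_ hgO)
    rw [Proj.basicOpen_eq_iSup_proj _ g]
    exact le_iSup (fun i => Proj.basicOpen (grading n) (GradedRing.proj (grading n) i g)) i

/-- Every closed point of `ℙⁿ` is of the form `[v]`. If the coordinate `X j` does not vanish at `p`,
then `v` consists of the values at `p` of the functions `X i / X j`. -/
theorem exists_eq_pt {p : Proj (grading n)} (hp : IsClosed ({p} : Set (Proj (grading n)))) :
    ∃ (v : Fin (n + 1) → ℂ) (hv : v ≠ 0), p = pt v hv := by
  obtain ⟨j, hj⟩ := exists_X_notMem p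
  have hpj : p ∈ Proj.basicOpen (grading n) (X j) := hj
  have hX (i : Fin (n + 1)) : (X i : MvPolynomial (Fin (n + 1)) ℂ) ∈ grading n (1 • 1) :=
    isHomogeneous_X ℂ i
  have key (i : Fin (n + 1)) : ∃ c : ℂ, X i - C c * X j ∈ p.asHomogeneousIdeal := by
    obtain ⟨c, hc⟩ := exists_evaluation_eq (structP n) hp hpj
      (Proj.awayToSection (grading n) (X j)
        (HomogeneousLocalization.Away.mk (grading n) (isHomogeneous_X ℂ j) 1 (X i) (hX i)))
    have := (evaluation_awayMk_eq_const_iff _ _ _ _).mp hc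
    rw [pow_one] at this
    exact ⟨c, this⟩
  choose c hc using key
  -- the value `c j` is `1` as well, but overwriting it makes this evident
  have hne : Function.update c j 1 ≠ 0 := Function.ne_iff.mpr ⟨j, by simp⟩
  refine ⟨_, hne, eq_pt hne (j := j) (by simp) fun i => ?_⟩
  rw [Function.update_self, C_1, one_mul]
  by_cases h : i = j
  · subst h
    rw [Function.update_self, C_1, one_mul, sub_self]
    exact zero_mem _
  · rw [Function.update_of_ne h]
    exact hc i

/-- A morphism from a closed subscheme of `ℙⁿ` to `ℙᵐ` is given on closed points, locally, by
homogeneous polynomials of a common degree: on the preimage of an affine chart `X j ≠ 0` the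
pullbacks of the functions `X i / X j` extend to fractions on a basic open set of `ℙⁿ`, since `Z` is
a closed subscheme, and these fractions are then brought to a common denominator. -/
theorem exists_local_formula {m : ℕ} {Z : Scheme.{0}} (ι : Z ⟶ Proj (grading n))
    [IsClosedImmersion ι] (f : Z ⟶ Proj (grading m)) (hf : f ≫ structP m = ι ≫ structP n) {z₀ : Z}
    {v : Fin (n + 1) → ℂ} (hv : v ≠ 0) (hz₀ : ι z₀ = pt v hv) :
    ∃ (d : ℕ) (A : Fin (m + 1) → MvPolynomial (Fin (n + 1)) ℂ) (j : Fin (m + 1)),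
      (∀ i, (A i).IsHomogeneous d) ∧ eval v (A j) ≠ 0 ∧
      ∀ (z : Z) (u : Fin (n + 1) → ℂ) (hu : u ≠ 0), ι z = pt u hu → eval u (A j) ≠ 0 →
        ∃ h, f z = pt (fun i => eval u (A i)) h := by
  obtain ⟨j, hj⟩ := exists_X_notMem (f z₀)
  set U := Proj.basicOpen (grading m) (X j) with hU
  obtain ⟨O, hO, hOW⟩ := ι.isEmbedding.isOpen_iff.mp (f ⁻¹ᵁ U).isOpen
  have hz₀O : ι z₀ ∈ O := by
    change z₀ ∈ ι ⁻¹' O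
    rw [hOW]
    exact hj
  obtain ⟨d, g, hd, hg, hpg, hgO⟩ := exists_isHomogeneous_basicOpen (O := ⟨O, hO⟩) hz₀O
  set V := Proj.basicOpen (grading n) g with hV
  have hVW : ι ⁻¹ᵁ V ≤ f ⁻¹ᵁ U := by
    intro z hz
    change z ∈ ((f ⁻¹ᵁ U : Z.Opens) : Set Z)
    rw [← hOW]
    exact hgO hz
  have hconst (c : ℂ) : ι.appLE V (ι ⁻¹ᵁ V) le_rfl (const (structP n) V c) =
      f.appLE U (ι ⁻¹ᵁ V) hVW (const (structP m) U c) := by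
    rw [← CommRingCat.comp_apply, ← CommRingCat.comp_apply, const_comp_appLE, const_comp_appLE, hf]
  have hX (i : Fin (m + 1)) : (X i : MvPolynomial (Fin (m + 1)) ℂ) ∈ grading m (1 • 1) :=
    isHomogeneous_X ℂ i
  let s (i : Fin (m + 1)) : Γ(Proj (grading m), U) := Proj.awayToSection (grading m) (X j)
    (HomogeneousLocalization.Away.mk (grading m) (isHomogeneous_X ℂ j) 1 (X i) (hX i))
  have hr (i : Fin (m + 1)) : ∃ (k : ℕ) (a : MvPolynomial (Fin (n + 1)) ℂ)
      (ha : a ∈ grading n (k • d)), ι.appLE V (ι ⁻¹ᵁ V) le_rfl (Proj.awayToSection (grading n) g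
        (HomogeneousLocalization.Away.mk (grading n) hg k a ha)) =
      f.appLE U (ι ⁻¹ᵁ V) hVW (s i) := by
    obtain ⟨r, hr⟩ := ι.app_surjective V (Proj.isAffineOpen_basicOpen (grading n) g hg hd)
      (f.appLE U (ι ⁻¹ᵁ V) hVW (s i))
    obtain ⟨y, hy⟩ := (ConcreteCategory.bijective_of_isIso
      (Proj.basicOpenIsoAway (grading n) g hg hd).hom).2 r
    obtain ⟨k, a, ha, rfl⟩ := HomogeneousLocalization.Away.mk_surjective (grading n) hg y
    refine ⟨k, a, ha, ?_⟩
    rw [← hr, ← hy, Scheme.Hom.app_eq_appLE]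
    rfl
  choose k a ha hk using hr
  -- the denominator of all fractions; the summand `1` makes `g ^ N` vanish where `g` does
  set N := ∑ i, k i + 1 with hN
  have hkN (i) : k i ≤ N := (Finset.single_le_sum (fun _ _ => Nat.zero_le _)
    (Finset.mem_univ i)).trans (Nat.le_succ _)
  refine ⟨N * d, fun i => if i = j then g ^ N else a i * g ^ (N - k i), j, fun i => ?_, ?_, ?_⟩
  · dsimp only
    split_ifs with h
    · rw [mul_comm]; exact hg.pow N
    · have := (show (a i).IsHomogeneous (k i * d) from ha i).mul (hg.pow (N - k i))
      rwa [mul_comm d, ← add_mul, Nat.add_sub_cancel' (hkN i)] at this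
  · dsimp only
    rw [if_pos rfl, map_pow]
    refine pow_ne_zero _ ?_
    refine (mem_pt hv hg).not.mp ?_
    rw [← hz₀]
    exact hpg
  · intro z u hu hz hne
    dsimp only at hne ⊢
    rw [if_pos rfl, map_pow] at hne
    have hgu : eval u g ≠ 0 := fun h => hne (by rw [h, zero_pow (Nat.succ_ne_zero _)])
    have hzV : z ∈ ι ⁻¹ᵁ V := by
      change g ∉ (ι z).asHomogeneousIdeal
      rwa [hz, mem_pt hu hg]
    have key (i) : X i - C (eval u (a i) / eval u g ^ k i) * X j ∈ (f z).asHomogeneousIdeal := by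
      have h1 := (evaluation_awayMk_eq_const_iff hg (ha i) (p := ι z) hzV
        (eval u (a i) / eval u g ^ k i)).mpr (by
          rw [hz, mem_pt hu (d := k i * d)]
          · simp [hgu]
          · refine IsHomogeneous.sub (ha i) ?_
            rw [← smul_eq_C_mul]
            refine Submodule.smul_mem (homogeneousSubmodule _ ℂ (k i * d)) _ ?_
            rw [mul_comm]
            exact hg.pow _)
      rw [← evaluation_appLE_eq_iff ι le_rfl hzV, hk i, hconst,
        evaluation_appLE_eq_iff f hVW hzV] at h1
      have := (evaluation_awayMk_eq_const_iff _ _ _ _).mp h1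
      rwa [pow_one] at this
    have hne' : (fun i => eval u (if i = j then g ^ N else a i * g ^ (N - k i))) ≠ 0 := by
      intro h
      have := congrFun h j
      rw [if_pos rfl, map_pow] at this
      exact hne this
    refine ⟨hne', eq_pt hne' (j := j) ?_ fun i => ?_⟩
    · rw [if_pos rfl, map_pow]
      exact hne
    · rw [if_pos rfl]
      split_ifs with h
      · subst h
        rw [sub_self]
        exact zero_mem _
      · have h3 := (f z).asHomogeneousIdeal.toIdeal.mul_mem_left (C (eval u g ^ N)) (key i)
        convert! h3 using 1
        have : eval u g ^ N = eval u g ^ k i * eval u g ^ (N - k i) := by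
          rw [← pow_add, Nat.add_sub_cancel' (hkN i)]
        have h4 : eval u g ^ N * (eval u (a i) / eval u g ^ k i) =
            eval u (a i * g ^ (N - k i)) := by
          rw [this, map_mul, map_pow]
          field_simp
        rw [mul_sub, ← mul_assoc, ← C_mul, h4, map_pow]

/-! ### Closed points of projective varieties -/

instance isReduced_vanishingIdeal_subscheme {X : Scheme.{0}} (Z : TopologicalSpace.Closeds X) :
    IsReduced (Scheme.IdealSheafData.vanishingIdeal Z).subscheme := by
  let I := Scheme.IdealSheafData.vanishingIdeal Z
  refine @IsReduced.of_openCover _ I.subschemeCover.openCover fun U => ?_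
  let U : X.affineOpens := U
  change IsReduced (Spec (CommRingCat.of (Γ(X, U.1) ⧸ I.ideal U)))
  have : _root_.IsReduced (Γ(X, U.1) ⧸ I.ideal U) := by
    rw [← Ideal.isRadical_iff_quotient_reduced]
    exact PrimeSpectrum.isRadical_vanishingIdeal _
  infer_instance

/-- The inclusion of `V(s)` in `ℙⁿ`, with target written as `Proj (grading n)`. -/
def projι (n : ℕ) (s : Set (MvPolynomial (Fin (n + 1)) ℂ)) :
    (projVariety n s).left ⟶ Proj (grading n) :=
  (Scheme.IdealSheafData.vanishingIdeal (zeros n s)).subschemeι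

instance (s : Set (MvPolynomial (Fin (n + 1)) ℂ)) : IsClosedImmersion (projι n s) := by
  delta projι
  exact inferInstanceAs (IsClosedImmersion
    (Scheme.IdealSheafData.vanishingIdeal (zeros n s)).subschemeι)

instance (s : Set (MvPolynomial (Fin (n + 1)) ℂ)) : IsReduced (projVariety n s).left :=
  isReduced_vanishingIdeal_subscheme _

theorem projι_structP (s : Set (MvPolynomial (Fin (n + 1)) ℂ)) :
    projι n s ≫ structP n = (projVariety n s).hom := rfl

theorem range_projι (s : Set (MvPolynomial (Fin (n + 1)) ℂ)) :
    Set.range (projι n s) = ProjectiveSpectrum.zeroLocus (grading n) s := by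
  refine (Scheme.IdealSheafData.range_subschemeι _).trans ?_
  exact Scheme.IdealSheafData.coe_support_vanishingIdeal _

theorem exists_projι_eq_pt_iff {s : Set (MvPolynomial (Fin (n + 1)) ℂ)}
    (hs : ∀ f ∈ s, ∃ d, f.IsHomogeneous d) {v : Fin (n + 1) → ℂ} (hv : v ≠ 0) :
    (∃ z, projι n s z = pt v hv) ↔ ∀ f ∈ s, eval v f = 0 := by
  rw [← Set.mem_range, range_projι]
  refine forall₂_congr fun f hf => ?_
  obtain ⟨d, hd⟩ := hs f hf
  exact mem_pt hv hd

/-- Since `V(s)` is reduced and of finite type over `ℂ`, morphisms from `V(s)` to projective space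
are determined by their effect on closed points. -/
theorem hom_ext_pt {s : Set (MvPolynomial (Fin (n + 1)) ℂ)} {m : ℕ}
    {f g : (projVariety n s).left ⟶ Proj (grading m)}
    (hf : f ≫ structP m = projι n s ≫ structP n) (hg : g ≫ structP m = projι n s ≫ structP n)
    (h : ∀ z v hv, projι n s z = pt v hv → f z = g z) : f = g := by
  have : LocallyOfFiniteType (f ≫ structP m) := by rw [hf]; infer_instance
  refine ext_of_apply_eq (structP m) Set.univ isClosed_univ.isLocallyClosed dense_univ
    (fun z _ hz => ?_) (hf.trans hg.symm)
  have hz' : IsClosed ({projι n s z} : Set (Proj (grading n))) := by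
    rw [← Set.image_singleton]
    exact (projι n s).isClosedEmbedding.isClosedMap _ hz
  obtain ⟨v, hv, hzv⟩ := exists_eq_pt hz'
  exact h z v hv hzv

/-! ### Linear automorphisms -/

/-- The linear substitution of variables dual to `L`: the pullback of polynomial functions. -/
def linSubst (L : (Fin (n + 1) → ℂ) ≃ₗ[ℂ] (Fin (n + 1) → ℂ)) :
    MvPolynomial (Fin (n + 1)) ℂ →ₐ[ℂ] MvPolynomial (Fin (n + 1)) ℂ :=
  aeval fun i => ∑ j, C (L (Pi.single j 1) i) * X j

theorem eval_linSubst (L : (Fin (n + 1) → ℂ) ≃ₗ[ℂ] (Fin (n + 1) → ℂ)) (v : Fin (n + 1) → ℂ)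
    (f : MvPolynomial (Fin (n + 1)) ℂ) : eval v (linSubst L f) = eval (L v) f := by
  have h : ∀ i, L v i = ∑ j, L (Pi.single j 1) i * v j := by
    intro i
    conv_lhs => rw [← Finset.univ_sum_single v, map_sum, Finset.sum_apply]
    refine Finset.sum_congr rfl fun j _ => ?_
    have : Pi.single j (v j) = v j • (Pi.single j 1 : Fin (n + 1) → ℂ) := by
      rw [← Pi.single_smul, smul_eq_mul, mul_one]
    rw [this, map_smul, Pi.smul_apply, smul_eq_mul, mul_comm]
  have h2 : ((aeval v).comp (linSubst L) : MvPolynomial (Fin (n + 1)) ℂ →ₐ[ℂ] ℂ) =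
      aeval (L v) := by
    ext i
    simp [linSubst, h]
  exact congr($h2 f)

theorem linSubst_comp (L L' : (Fin (n + 1) → ℂ) ≃ₗ[ℂ] (Fin (n + 1) → ℂ))
    (f : MvPolynomial (Fin (n + 1)) ℂ) :
    linSubst L (linSubst L' f) = linSubst (L.trans L') f := by
  refine MvPolynomial.funext fun v => ?_
  simp [eval_linSubst]

theorem linSubst_refl (f : MvPolynomial (Fin (n + 1)) ℂ) :
    linSubst (LinearEquiv.refl ℂ _) f = f :=
  MvPolynomial.funext fun v => by simp [eval_linSubst]

theorem isHomogeneous_linSubst (L : (Fin (n + 1) → ℂ) ≃ₗ[ℂ] (Fin (n + 1) → ℂ)) {d : ℕ}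
    {f : MvPolynomial (Fin (n + 1)) ℂ} (hf : f.IsHomogeneous d) :
    (linSubst L f).IsHomogeneous d := by
  have h := hf.aeval (n := 1) (fun i => ∑ j, C (L (Pi.single j 1) i) * X j) (fun i => by
    refine IsHomogeneous.sum _ _ _ fun j _ => ?_
    exact (isHomogeneous_C _ _).mul (isHomogeneous_X ℂ _))
  rwa [one_mul] at h

/-- `linSubst L` as a homomorphism of graded rings. -/
def gradedSubst (L : (Fin (n + 1) → ℂ) ≃ₗ[ℂ] (Fin (n + 1) → ℂ)) : grading n →+*ᵍ grading n where
  __ := (linSubst L).toRingHom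
  map_mem := isHomogeneous_linSubst L

theorem irrelevant_le_map (L : (Fin (n + 1) → ℂ) ≃ₗ[ℂ] (Fin (n + 1) → ℂ)) :
    HomogeneousIdeal.irrelevant (grading n) ≤
      (HomogeneousIdeal.irrelevant (grading n)).map (gradedSubst L) := by
  intro f hf
  have h1 : f = gradedSubst L (gradedSubst L.symm f) := by
    change f = linSubst L (linSubst L.symm f)
    rw [linSubst_comp, L.self_trans_symm, linSubst_refl]
  rw [h1]
  refine Ideal.mem_map_of_mem (gradedSubst L) ?_
  change _ ∈ HomogeneousIdeal.irrelevant (grading n)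
  have hf' : f ∈ HomogeneousIdeal.irrelevant (grading n) := hf
  rw [HomogeneousIdeal.mem_irrelevant_iff, GradedRing.proj_apply] at hf' ⊢
  rw [← GradedRingHom.map_directSumDecompose, hf', map_zero]

/-- The automorphism `[v] ↦ [L v]` of `ℙⁿ` induced by a linear automorphism of `ℂⁿ⁺¹`. -/
def projMap (L : (Fin (n + 1) → ℂ) ≃ₗ[ℂ] (Fin (n + 1) → ℂ)) :
    Proj (grading n) ⟶ Proj (grading n) :=
  Proj.map (gradedSubst L) (irrelevant_le_map L)

theorem projMap_comp (L L' : (Fin (n + 1) → ℂ) ≃ₗ[ℂ] (Fin (n + 1) → ℂ)) :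
    projMap L ≫ projMap L' = projMap (L.trans L') := by
  rw [projMap, projMap, ← Proj.map_comp]
  have : (gradedSubst L).comp (gradedSubst L') = gradedSubst (L.trans L') := by
    refine GradedRingHom.ext fun f => ?_
    exact linSubst_comp L L' f
  simp_rw [this]
  rfl

theorem projMap_refl : projMap (LinearEquiv.refl ℂ (Fin (n + 1) → ℂ)) = 𝟙 _ := by
  rw [← Proj.map_id, projMap]
  have : gradedSubst (LinearEquiv.refl ℂ (Fin (n + 1) → ℂ)) = .id (grading n) := by
    refine GradedRingHom.ext fun f => ?_
    exact linSubst_refl f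
  simp_rw [this]

theorem projMap_pt (L : (Fin (n + 1) → ℂ) ≃ₗ[ℂ] (Fin (n + 1) → ℂ)) {v : Fin (n + 1) → ℂ}
    (hv : v ≠ 0) : projMap L (pt v hv) = pt (L v) (L.map_ne_zero_iff.mpr hv) := by
  refine ProjectiveSpectrum.ext (homogeneousIdeal_ext fun d f hf => ?_)
  rw [mem_pt _ hf, ← eval_linSubst]
  exact mem_pt hv (isHomogeneous_linSubst L hf)

theorem projMap_structP (L : (Fin (n + 1) → ℂ) ≃ₗ[ℂ] (Fin (n + 1) → ℂ)) :
    projMap L ≫ structP n = structP n := by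
  have key (i : ℕ) (hi : 0 < i) (s : MvPolynomial (Fin (n + 1)) ℂ) (hs : s ∈ grading n i) :
      Proj.awayι (grading n) (gradedSubst L s) ((gradedSubst L).2 hs) hi ≫ projMap L ≫ structP n =
        Proj.awayι (grading n) (gradedSubst L s) ((gradedSubst L).2 hs) hi ≫ structP n := by
    change Proj.awayι _ _ _ _ ≫ Proj.map _ _ ≫ Proj.toSpecZero (grading n) ≫ Spec.map _ =
      Proj.awayι _ _ _ _ ≫ Proj.toSpecZero (grading n) ≫ Spec.map _
    rw [Proj.awayι_comp_map_assoc _ _ hi _ hs, Proj.awayι_toSpecZero_assoc,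
      Proj.awayι_toSpecZero_assoc, ← Spec.map_comp, ← Spec.map_comp, ← Spec.map_comp]
    congr 1
    ext c
    change Localization.mk (linSubst L (C c)) _ = Localization.mk (C c) _
    congr 1
    · exact (linSubst L).commutes c
    · exact Subtype.ext (map_one (linSubst L))
  exact (Proj.mapAffineOpenCover (gradedSubst L) (irrelevant_le_map L)).openCover.hom_ext _ _
    fun s => key s.1 s.1.2 s.2 s.2.2

theorem le_map_vanishingIdeal {X : Scheme.{0}} (f : X ⟶ X) (Z : TopologicalSpace.Closeds X)
    (h : f '' Z ⊆ Z) : Scheme.IdealSheafData.vanishingIdeal Z ≤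
      (Scheme.IdealSheafData.vanishingIdeal Z).map f := by
  rw [Scheme.IdealSheafData.map_vanishingIdeal]
  exact Scheme.IdealSheafData.vanishingIdeal_antimono (TopologicalSpace.Closeds.closure_le.mpr h)

/-- A linear automorphism that preserves the equations of `V(s)` induces an automorphism of
`V(s)`. -/
theorem exists_projVariety_iso (L : (Fin (n + 1) → ℂ) ≃ₗ[ℂ] (Fin (n + 1) → ℂ))
    {s : Set (MvPolynomial (Fin (n + 1)) ℂ)} (hL : ∀ f ∈ s, ∀ v, eval (L v) f = eval v f) :
    ∃ Φ : projVariety n s ≅ projVariety n s, Φ.hom.left ≫ projι n s = projι n s ≫ projMap L := by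
  have key : ∀ L : (Fin (n + 1) → ℂ) ≃ₗ[ℂ] (Fin (n + 1) → ℂ),
      (∀ f ∈ s, ∀ v, eval (L v) f = eval v f) → ∃ Φ : projVariety n s ⟶ projVariety n s,
        Φ.left ≫ projι n s = projι n s ≫ projMap L := by
    intro L hL
    let Z : TopologicalSpace.Closeds (Proj (grading n)) := zeros n s
    have hI : Scheme.IdealSheafData.vanishingIdeal Z ≤
        (Scheme.IdealSheafData.vanishingIdeal Z).map (projMap L) := by
      apply le_map_vanishingIdeal
      rintro _ ⟨p, hp, rfl⟩ f hf
      have h1 : linSubst L f = f := MvPolynomial.funext fun v => by rw [eval_linSubst, hL f hf]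
      change linSubst L f ∈ p.asHomogeneousIdeal
      rw [h1]
      exact hp hf
    let Φ : (projVariety n s).left ⟶ (projVariety n s).left :=
      Scheme.IdealSheafData.subschemeMap _ _ (projMap L) hI
    have h1 : Φ ≫ projι n s = projι n s ≫ projMap L :=
      Scheme.IdealSheafData.subschemeMap_subschemeι _ _ (projMap L) hI
    refine ⟨Over.homMk Φ ?_, h1⟩
    rw [← projι_structP, reassoc_of% h1, projMap_structP]
  have hL' : ∀ f ∈ s, ∀ v, eval (L.symm v) f = eval v f := fun f hf v => by
    rw [← hL f hf (L.symm v), L.apply_symm_apply]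
  obtain ⟨Φ, hΦ⟩ := key L hL
  obtain ⟨Ψ, hΨ⟩ := key L.symm hL'
  refine ⟨⟨Φ, Ψ, ?_, ?_⟩, hΦ⟩
  · ext1
    rw [← cancel_mono (projι n s), Over.comp_left, Category.assoc, hΨ, reassoc_of% hΦ,
      projMap_comp, L.self_trans_symm, projMap_refl, Category.comp_id]
    exact (Category.id_comp _).symm
  · ext1
    rw [← cancel_mono (projι n s), Over.comp_left, Category.assoc, hΦ, reassoc_of% hΨ,
      projMap_comp, L.symm_trans_self, projMap_refl, Category.comp_id]
    exact (Category.id_comp _).symm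

end Proj

/-! ### Weighted homogeneous polynomials and factorization -/

section Weighted

variable {σ : Type*}

/-- The substitution `X i ↦ X i * T ^ w i`, i.e. the action of the one-parameter torus on
polynomial functions in which `X i` has weight `w i`. -/
def scaleHom (w : σ → ℕ) : MvPolynomial σ ℂ →ₐ[ℂ] Polynomial (MvPolynomial σ ℂ) :=
  aeval fun i => Polynomial.C (X i) * Polynomial.X ^ w i

theorem scaleHom_monomial (w : σ → ℕ) (s : σ →₀ ℕ) (c : ℂ) :
    scaleHom w (monomial s c) =
      Polynomial.C (monomial s c) * Polynomial.X ^ Finsupp.weight w s := by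
  rw [scaleHom, aeval_monomial, monomial_eq, Finsupp.weight_apply, Finsupp.prod, Finsupp.prod,
    Finsupp.sum, map_mul, map_prod, ← Finset.prod_pow_eq_pow_sum, mul_assoc]
  congr 1
  rw [← Finset.prod_mul_distrib]
  refine Finset.prod_congr rfl fun i _ => ?_
  rw [mul_pow, map_pow, smul_eq_mul, ← pow_mul, mul_comm (w i)]

theorem coeff_scaleHom (w : σ → ℕ) (f : MvPolynomial σ ℂ) (k : ℕ) (s : σ →₀ ℕ) :
    coeff s ((scaleHom w f).coeff k) = if Finsupp.weight w s = k then coeff s f else 0 := by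
  classical
  induction f using MvPolynomial.induction_on' with
  | monomial t c =>
    rw [scaleHom_monomial, Polynomial.coeff_C_mul_X_pow]
    by_cases hts : t = s
    · subst hts
      by_cases h : Finsupp.weight w t = k
      · simp [h]
      · simp [h, Ne.symm h]
    · rw [coeff_monomial, if_neg hts]
      by_cases h : k = Finsupp.weight w t <;> simp [h, coeff_monomial, hts]
  | add p q hp hq =>
    rw [map_add, Polynomial.coeff_add, coeff_add, hp, hq, coeff_add]
    split_ifs <;> simp

/-- Weighted homogeneous polynomials are the eigenvectors of the torus action. -/
theorem scaleHom_eq_iff (w : σ → ℕ) (f : MvPolynomial σ ℂ) (d : ℕ) :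
    scaleHom w f = Polynomial.C f * Polynomial.X ^ d ↔ IsWeightedHomogeneous w f d := by
  constructor
  · intro h s hs
    by_contra hne
    have := coeff_scaleHom w f (Finsupp.weight w s) s
    rw [h, Polynomial.coeff_C_mul_X_pow, if_neg hne, if_pos rfl, coeff_zero] at this
    exact hs this.symm
  · intro h
    ext k s
    rw [coeff_scaleHom, Polynomial.coeff_C_mul_X_pow]
    by_cases hs : coeff s f = 0
    · split_ifs <;> simp [hs]
    · rw [h hs]
      by_cases hk : d = k
      · simp [hk]
      · simp [hk, Ne.symm hk]

theorem eval_one_scaleHom (w : σ → ℕ) (f : MvPolynomial σ ℂ) :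
    Polynomial.eval 1 (scaleHom w f) = f := by
  have h : ((Polynomial.aeval (R := MvPolynomial σ ℂ) (1 : MvPolynomial σ ℂ)).restrictScalars
      ℂ).comp (scaleHom w) = AlgHom.id ℂ _ := by
    ext1 i
    simp [scaleHom]
  have := congr($h f)
  simpa [Polynomial.aeval_def] using this

theorem scaleHom_ne_zero {w : σ → ℕ} {f : MvPolynomial σ ℂ} (hf : f ≠ 0) : scaleHom w f ≠ 0 := by
  intro h
  apply hf
  rw [← eval_one_scaleHom w f, h, Polynomial.eval_zero]

/-- A factor of a monomial is a monomial: its degree and its trailing degree agree. -/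
theorem _root_.Polynomial.exists_eq_C_mul_X_pow_of_mul {A : Type*} [CommRing A] [IsDomain A]
    {p q : Polynomial A} {a : A} {d : ℕ} (ha : a ≠ 0)
    (h : p * q = Polynomial.C a * Polynomial.X ^ d) :
    ∃ e ≤ d, ∃ b, p = Polynomial.C b * Polynomial.X ^ e := by
  have hpq : p * q ≠ 0 := by
    rw [h, Polynomial.C_mul_X_pow_eq_monomial]
    simpa using ha
  have hp := left_ne_zero_of_mul hpq
  have hq := right_ne_zero_of_mul hpq
  have h1 : p.natDegree + q.natDegree = d := by
    rw [← Polynomial.natDegree_mul hp hq, h, Polynomial.natDegree_C_mul_X_pow _ _ ha]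
  have h2 : p.natTrailingDegree + q.natTrailingDegree = d := by
    rw [← Polynomial.natTrailingDegree_mul hp hq, h, Polynomial.C_mul_X_pow_eq_monomial,
      Polynomial.natTrailingDegree_monomial ha]
  have h3 := p.natTrailingDegree_le_natDegree
  have h4 := q.natTrailingDegree_le_natDegree
  refine ⟨p.natDegree, by omega, p.leadingCoeff, ?_⟩
  ext k
  rw [Polynomial.coeff_C_mul_X_pow]
  split_ifs with hk
  · rw [hk]; rfl
  · rcases lt_or_gt_of_ne hk with hk | hk
    · exact Polynomial.coeff_eq_zero_of_lt_natTrailingDegree (by omega)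
    · exact Polynomial.coeff_eq_zero_of_natDegree_lt hk

/-- A common factor of weighted homogeneous polynomials of the same degree is weighted
homogeneous, and so are the cofactors, again of a common degree. -/
theorem exists_isWeightedHomogeneous_of_mul {ι : Type*} {w : σ → ℕ} {h : MvPolynomial σ ℂ}
    {c : ι → MvPolynomial σ ℂ} {d : ℕ} (hc : ∀ k, IsWeightedHomogeneous w (h * c k) d) {k₀ : ι}
    (hk₀ : h * c k₀ ≠ 0) :
    ∃ e f, IsWeightedHomogeneous w h e ∧ ∀ k, IsWeightedHomogeneous w (c k) f := by
  simp_rw [← scaleHom_eq_iff, map_mul] at hc ⊢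
  obtain ⟨e, hed, b, hb⟩ := Polynomial.exists_eq_C_mul_X_pow_of_mul hk₀
    ((hc k₀).trans (by rw [map_mul]))
  have hbh : b = h := by
    rw [← eval_one_scaleHom w h, hb]
    simp
  subst hbh
  refine ⟨e, d - e, hb, fun k => ?_⟩
  have hk := hc k
  rw [hb] at hk
  have hne : Polynomial.C b * Polynomial.X ^ e ≠ 0 := by
    rw [← hb]
    exact scaleHom_ne_zero (left_ne_zero_of_mul hk₀)
  apply mul_left_cancel₀ hne
  rw [hk]
  nth_rw 1 [← Nat.add_sub_cancel' hed]
  rw [pow_add]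
  ring

end Weighted

/-- A family of elements of a factorial ring is a multiple of a family `c` without common factors.
The latter is used in the form: if the family `b * c i / c k` is integral, then so is `b / c k`. -/
theorem exists_eq_mul_coprime {A : Type*} [CommRing A] [UniqueFactorizationMonoid A]
    {ι : Type*} [Fintype ι] [Nonempty ι] (f : ι → A) :
    ∃ (g : A) (c : ι → A), (∀ i, f i = g * c i) ∧ ∀ b k, (∀ i, c k ∣ b * c i) → c k ∣ b := by
  classical
  let _ : StrongNormalizationMonoid A := UniqueFactorizationMonoid.strongNormalizationMonoid
  let _ := UniqueFactorizationMonoid.toNormalizedGCDMonoid A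
  obtain ⟨c, hc, hc1⟩ := Finset.univ.extract_gcd f Finset.univ_nonempty
  refine ⟨_, c, fun i => hc i (Finset.mem_univ i), fun b k h => ?_⟩
  have := (Finset.dvd_gcd fun i _ => h i).trans (Finset.gcd_mul_left' Finset.univ c b).dvd
  rwa [hc1, mul_one] at this

/-- The four number lemma: a rank one `2 × 2` matrix over a factorial domain is the product of a
column and a row. -/
theorem exists_factor_of_mul_eq_mul {A : Type*} [CommRing A] [IsDomain A]
    [UniqueFactorizationMonoid A] {u v s t : A} (h : u * v = s * t) :
    ∃ a b p q, u = a * p ∧ v = b * q ∧ s = a * q ∧ t = b * p := by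
  by_cases hu : u = 0
  · rw [hu, zero_mul] at h
    rcases mul_eq_zero.mp h.symm with hs | ht
    · exact ⟨0, 1, t, v, by simp [hu, hs]⟩
    · exact ⟨s, v, 0, 1, by simp [hu, ht]⟩
  · obtain ⟨a, p, ⟨q, rfl⟩, ⟨b, rfl⟩, rfl⟩ := exists_dvd_and_dvd_of_dvd_mul (Dvd.intro _ h)
    refine ⟨a, b, p, q, rfl, ?_, rfl, mul_comm _ _⟩
    apply mul_left_cancel₀ hu
    rw [h]
    ring

/-! ### Bihomogeneous formulas for maps between quadric surfaces -/

/-- The Segre map, in the coordinates `[u : x : y : z : w]`: a pair of vectors `(a, b)`, `(p, q)`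
is sent to `(0, ap, bq, aq, bp)`. -/
def segre {A : Type*} [CommRing A] (s : Fin 4 → A) : Fin 5 → A :=
  ![0, s 0 * s 2, s 1 * s 3, s 0 * s 3, s 1 * s 2]

/-- A quadruple of numbers is a pair of homogeneous coordinates of points of `ℙ¹` if neither the
first two nor the last two numbers are both zero. -/
def IsBiproj (s : Fin 4 → ℂ) : Prop := (s 0 ≠ 0 ∨ s 1 ≠ 0) ∧ (s 2 ≠ 0 ∨ s 3 ≠ 0)

theorem segre_ne_zero_iff {s : Fin 4 → ℂ} : segre s ≠ 0 ↔ IsBiproj s := by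
  rw [Function.ne_iff, IsBiproj]
  simp only [segre, Fin.exists_fin_succ, Matrix.cons_val_zero, Matrix.cons_val_succ,
    Pi.zero_apply, ne_eq, not_true_eq_false, false_or, mul_eq_zero, not_or, IsEmpty.exists_iff,
    or_false]
  tauto

/-- Bihomogeneous polynomials of bidegree `(m, n)` in the variables `(X 0, X 1)` and
`(X 2, X 3)`. -/
def IsBihom (f : MvPolynomial (Fin 4) ℂ) (m n : ℕ) : Prop :=
  IsWeightedHomogeneous ![1, 1, 0, 0] f m ∧ IsWeightedHomogeneous ![0, 0, 1, 1] f n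

theorem IsBihom.aeval_mul_pow {A : Type*} [CommRing A] [Algebra ℂ A]
    {f : MvPolynomial (Fin 4) ℂ} {m n : ℕ} (hf : IsBihom f m n) (v : Fin 4 → A) (s t : A) :
    aeval ![v 0 * s, v 1 * s, v 2 * t, v 3 * t] f = aeval v f * s ^ m * t ^ n := by
  rw [← hf.1.aeval_mul_pow, ← hf.2.aeval_mul_pow]
  congr 2
  ext i
  fin_cases i <;> simp

theorem exists_isBihom_of_mul {ι : Type*} {h : MvPolynomial (Fin 4) ℂ}
    {c : ι → MvPolynomial (Fin 4) ℂ} {m n : ℕ} (hc : ∀ k, IsBihom (h * c k) m n) {k₀ : ι}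
    (hk₀ : h * c k₀ ≠ 0) :
    ∃ e f e' f', IsBihom h e e' ∧ ∀ k, IsBihom (c k) f f' := by
  obtain ⟨e, f, h1, h2⟩ := exists_isWeightedHomogeneous_of_mul (fun k => (hc k).1) hk₀
  obtain ⟨e', f', h1', h2'⟩ := exists_isWeightedHomogeneous_of_mul (fun k => (hc k).2) hk₀
  exact ⟨e, f, e', f', ⟨h1, h1'⟩, fun k => ⟨h2 k, h2' k⟩⟩

/-- The pullback to `ℙ¹ × ℙ¹` under the Segre map. -/
def segrePullback : MvPolynomial (Fin 5) ℂ →ₐ[ℂ] MvPolynomial (Fin 4) ℂ :=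
  aeval (segre X)

theorem eval_segrePullback (v : Fin 4 → ℂ) (f : MvPolynomial (Fin 5) ℂ) :
    eval v (segrePullback f) = eval (segre v) f := by
  have h : ((aeval v).comp segrePullback : MvPolynomial (Fin 5) ℂ →ₐ[ℂ] ℂ) = aeval (segre v) := by
    ext i
    fin_cases i <;> simp [segrePullback, segre]
  exact congr($h f)

theorem isBihom_segrePullback {f : MvPolynomial (Fin 5) ℂ} {d : ℕ} (hf : f.IsHomogeneous d) :
    IsBihom (segrePullback f) d d := by
  have key (w : Fin 4 → ℕ) (hw : ∀ i, scaleHom w (segre X i) =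
      Polynomial.C (segre X i) * Polynomial.X) :
      IsWeightedHomogeneous w (segrePullback f) d := by
    rw [← scaleHom_eq_iff]
    have h1 : scaleHom w (segrePullback f) =
        aeval (fun i => Polynomial.C (segre X i) * Polynomial.X) f := by
      simp_rw [← hw]
      exact comp_aeval_apply (segre X) (scaleHom w) f
    have h2 : aeval (fun i => Polynomial.C (segre X i)) f = Polynomial.C (segrePullback f) :=
      (comp_aeval_apply (segre X) (Polynomial.CAlgHom (R := ℂ)) f).symm
    rw [h1, hf.aeval_mul_pow, h2]
  constructor <;> refine key _ fun i => ?_ <;> fin_cases i <;>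
    simp [segre, scaleHom] <;> ring

/-- Polynomials vanishing at all pairs of points of `ℙ¹` outside a hypersurface are zero. -/
theorem eq_zero_of_eval_eq_zero {f g : MvPolynomial (Fin 4) ℂ} (hg : g ≠ 0)
    (h : ∀ u, IsBiproj u → eval u g ≠ 0 → eval u f = 0) : f = 0 := by
  have h0 : g * (X 0 * X 2) * f = 0 := by
    refine MvPolynomial.funext fun u => ?_
    simp only [map_mul, eval_X, map_zero]
    by_cases hu : eval u g * (u 0 * u 2) = 0
    · rw [hu, zero_mul]
    · rw [← ne_eq, mul_ne_zero_iff, mul_ne_zero_iff] at hu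
      rw [h u ⟨Or.inl hu.2.1, Or.inl hu.2.2⟩ hu.1, mul_zero]
  exact (mul_eq_zero.mp h0).resolve_left (mul_ne_zero hg (mul_ne_zero (X_ne_zero _) (X_ne_zero _)))

/-- A correspondence from `ℙ¹ × ℙ¹` to the quadric surface which is locally given by homogeneous
polynomials in the Segre coordinates is globally given by two pairs of bihomogeneous
polynomials.

A local formula is divided by the greatest common divisor of its entries. The result is independent
of the local formula up to constants, hence it is valid everywhere, and it factors by the four
number lemma. -/
theorem exists_global_formula (R : (Fin 4 → ℂ) → (Fin 5 → ℂ) → Prop)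
    (hprop : ∀ u w w', R u w → R u w' → ∀ i j, w i * w' j = w j * w' i)
    (hquad : ∀ u w, R u w → w 0 = 0 ∧ w 1 * w 2 = w 3 * w 4)
    (hsmul : ∀ u w (c : ℂ), c ≠ 0 → R u w → R u (c • w))
    (hloc : ∀ x, IsBiproj x → ∃ (d : ℕ) (F : Fin 5 → MvPolynomial (Fin 5) ℂ) (j : Fin 5),
      (∀ i, (F i).IsHomogeneous d) ∧ eval (segre x) (F j) ≠ 0 ∧
      ∀ u, IsBiproj u → eval (segre u) (F j) ≠ 0 → R u fun i => eval (segre u) (F i)) :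
    ∃ (S : Fin 4 → MvPolynomial (Fin 4) ℂ) (m n m' n' : ℕ),
      (IsBihom (S 0) m n ∧ IsBihom (S 1) m n ∧ IsBihom (S 2) m' n' ∧ IsBihom (S 3) m' n') ∧
      ∀ u, IsBiproj u → R u (segre fun i => eval u (S i)) := by
  have hloc' : ∀ x, IsBiproj x → ∃ (d : ℕ) (F : Fin 5 → MvPolynomial (Fin 4) ℂ) (j : Fin 5),
      (∀ i, IsBihom (F i) d d) ∧ eval x (F j) ≠ 0 ∧
      ∀ u, IsBiproj u → eval u (F j) ≠ 0 → R u fun i => eval u (F i) := by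
    intro x hx
    obtain ⟨d, F, j, h1, h2, h3⟩ := hloc x hx
    refine ⟨d, fun i => segrePullback (F i), j, fun i => isBihom_segrePullback (h1 i), ?_⟩
    simp_rw [eval_segrePullback]
    exact ⟨h2, h3⟩
  obtain ⟨d, F, j, hF, hj, hR⟩ := hloc' ![1, 0, 1, 0] (by simp [IsBiproj])
  have hFj : F j ≠ 0 := fun h => hj (by rw [h, map_zero])
  obtain ⟨g, c, hc, hcop⟩ := exists_eq_mul_coprime F
  have hgc : g * c j ≠ 0 := by rwa [← hc]
  have hg : g ≠ 0 := left_ne_zero_of_mul hgc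
  have hF0 : F 0 = 0 := eq_zero_of_eval_eq_zero hFj fun u hu hne => (hquad u _ (hR u hu hne)).1
  have hF1 : F 1 * F 2 - F 3 * F 4 = 0 := eq_zero_of_eval_eq_zero hFj fun u hu hne => by
    rw [map_sub, map_mul, map_mul, sub_eq_zero]
    exact (hquad u _ (hR u hu hne)).2
  have hc0 : c 0 = 0 := (mul_eq_zero.mp ((hc 0).symm.trans hF0)).resolve_left hg
  have hc1 : c 1 * c 2 = c 3 * c 4 := by
    apply mul_left_cancel₀ (mul_ne_zero hg hg)
    rw [hc, hc, hc, hc] at hF1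
    linear_combination hF1
  obtain ⟨a, b, p, q, h1, h2, h3, h4⟩ := exists_factor_of_mul_eq_mul hc1
  have hcs : c = segre ![a, b, p, q] := by
    ext1 i
    fin_cases i <;> simp [segre, *]
  -- near any point, a local formula is a multiple of the reduced one, by a factor `h` that does not
  -- vanish there
  have hglob : ∀ u, IsBiproj u → R u fun i => eval u (c i) := by
    intro x hx
    obtain ⟨d', F', j', hF', hj', hR'⟩ := hloc' x hx
    have hFj' : F' j' ≠ 0 := fun h => hj' (by rw [h, map_zero])
    have hprop' (i k) : F' i * c k = F' k * c i := by
      apply mul_left_cancel₀ hg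
      rw [← sub_eq_zero]
      refine eq_zero_of_eval_eq_zero (mul_ne_zero hFj hFj') fun u hu hne => ?_
      rw [map_mul, mul_ne_zero_iff] at hne
      have := hprop u _ _ (hR' u hu hne.2) (hR u hu hne.1) i k
      simp only [hc, map_mul, map_sub] at this ⊢
      linear_combination this
    obtain ⟨h, hh⟩ := hcop (F' j) j fun i => ⟨F' i, by rw [mul_comm (c j), hprop']⟩
    have hh' (i) : F' i = h * c i := by
      apply mul_right_cancel₀ (right_ne_zero_of_mul hgc)
      rw [hprop', hh]
      ring
    have hhx : eval x h ≠ 0 := by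
      rw [hh', map_mul] at hj'
      exact left_ne_zero_of_mul hj'
    have := hsmul x _ _ (inv_ne_zero hhx) (hR' x hx hj')
    convert! this using 1
    ext i
    simp only [Pi.smul_apply, hh', map_mul, smul_eq_mul]
    field_simp
  obtain ⟨-, e, -, e', -, hce⟩ := exists_isBihom_of_mul (fun k => by rw [← hc]; exact hF k) hgc
  have hcne : c j ≠ 0 := right_ne_zero_of_mul hgc
  -- the entries of `c` have a common bidegree, hence so do `a, b` and `p, q`
  have hab : ∃ m n, IsBihom a m n ∧ IsBihom b m n := by
    have hpq : p ≠ 0 ∧ (a ≠ 0 ∨ b ≠ 0) ∨ q ≠ 0 ∧ (a ≠ 0 ∨ b ≠ 0) := by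
      by_contra hcon
      apply hcne
      rw [hcs]
      fin_cases j <;> simp [segre] <;> tauto
    have aux (r : MvPolynomial (Fin 4) ℂ) (hr : r ≠ 0 ∧ (a ≠ 0 ∨ b ≠ 0))
        (h1 : IsBihom (r * a) e e') (h2 : IsBihom (r * b) e e') :
        ∃ m n, IsBihom a m n ∧ IsBihom b m n := by
      have hcc : ∀ k : Bool, IsBihom (r * cond k a b) e e' := by
        rintro (_ | _)
        exacts [h2, h1]
      obtain ⟨k₀, hk₀⟩ : ∃ k₀ : Bool, r * cond k₀ a b ≠ 0 := by
        rcases hr.2 with h | h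
        exacts [⟨true, mul_ne_zero hr.1 h⟩, ⟨false, mul_ne_zero hr.1 h⟩]
      obtain ⟨-, m, -, n, -, hmn⟩ := exists_isBihom_of_mul hcc hk₀
      exact ⟨m, n, hmn true, hmn false⟩
    rcases hpq with h | h
    · exact aux p h (by rw [mul_comm, ← h1]; exact hce 1) (by rw [mul_comm, ← h4]; exact hce 4)
    · exact aux q h (by rw [mul_comm, ← h3]; exact hce 3) (by rw [mul_comm, ← h2]; exact hce 2)
  have hpq : ∃ m n, IsBihom p m n ∧ IsBihom q m n := by
    have hab : a ≠ 0 ∧ (p ≠ 0 ∨ q ≠ 0) ∨ b ≠ 0 ∧ (p ≠ 0 ∨ q ≠ 0) := by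
      by_contra hcon
      apply hcne
      rw [hcs]
      fin_cases j <;> simp [segre] <;> tauto
    have aux (r : MvPolynomial (Fin 4) ℂ) (hr : r ≠ 0 ∧ (p ≠ 0 ∨ q ≠ 0))
        (h1 : IsBihom (r * p) e e') (h2 : IsBihom (r * q) e e') :
        ∃ m n, IsBihom p m n ∧ IsBihom q m n := by
      have hcc : ∀ k : Bool, IsBihom (r * cond k p q) e e' := by
        rintro (_ | _)
        exacts [h2, h1]
      obtain ⟨k₀, hk₀⟩ : ∃ k₀ : Bool, r * cond k₀ p q ≠ 0 := by
        rcases hr.2 with h | h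
        exacts [⟨true, mul_ne_zero hr.1 h⟩, ⟨false, mul_ne_zero hr.1 h⟩]
      obtain ⟨-, m, -, n, -, hmn⟩ := exists_isBihom_of_mul hcc hk₀
      exact ⟨m, n, hmn true, hmn false⟩
    rcases hab with h | h
    · exact aux a h (by rw [← h1]; exact hce 1) (by rw [← h3]; exact hce 3)
    · exact aux b h (by rw [← h4]; exact hce 4) (by rw [← h2]; exact hce 2)
  obtain ⟨m, n, ha, hb⟩ := hab
  obtain ⟨m', n', hp, hq⟩ := hpq
  refine ⟨![a, b, p, q], m, n, m', n', ⟨ha, hb, hp, hq⟩, fun u hu => ?_⟩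
  convert! hglob u hu using 1
  ext i
  rw [hcs]
  fin_cases i <;> simp [segre]

/-! ### Bidegrees of an automorphism -/

theorem IsBihom.mul {f g : MvPolynomial (Fin 4) ℂ} {m n m' n' : ℕ} (hf : IsBihom f m n)
    (hg : IsBihom g m' n') : IsBihom (f * g) (m + m') (n + n') :=
  ⟨hf.1.mul hg.1, hf.2.mul hg.2⟩

theorem IsBihom.inj {f : MvPolynomial (Fin 4) ℂ} {m n m' n' : ℕ} (hf0 : f ≠ 0)
    (hf : IsBihom f m n) (hf' : IsBihom f m' n') : m = m' ∧ n = n' :=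
  ⟨hf.1.inj_right hf0 hf'.1, hf.2.inj_right hf0 hf'.2⟩

theorem isBihom_X_left {i : Fin 4} (hi : i = 0 ∨ i = 1) : IsBihom (X i) 1 0 := by
  constructor <;> rcases hi with rfl | rfl <;> exact isWeightedHomogeneous_X _ _ _

theorem isBihom_X_right {i : Fin 4} (hi : i = 2 ∨ i = 3) : IsBihom (X i) 0 1 := by
  constructor <;> rcases hi with rfl | rfl <;> exact isWeightedHomogeneous_X _ _ _

/-- The bidegree of a composition with two pairs of bihomogeneous polynomials. -/
theorem IsBihom.bind₁ {S : Fin 4 → MvPolynomial (Fin 4) ℂ} {m n m' n' : ℕ}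
    (hS : IsBihom (S 0) m n ∧ IsBihom (S 1) m n ∧ IsBihom (S 2) m' n' ∧ IsBihom (S 3) m' n')
    {f : MvPolynomial (Fin 4) ℂ} {k l : ℕ} (hf : IsBihom f k l) :
    IsBihom (bind₁ S f) (m * k + m' * l) (n * k + n' * l) := by
  have key (w : Fin 4 → ℕ) (a b : ℕ) (h0 : IsWeightedHomogeneous w (S 0) a)
      (h1 : IsWeightedHomogeneous w (S 1) a) (h2 : IsWeightedHomogeneous w (S 2) b)
      (h3 : IsWeightedHomogeneous w (S 3) b) :
      IsWeightedHomogeneous w (MvPolynomial.bind₁ S f) (a * k + b * l) := by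
    rw [← scaleHom_eq_iff] at *
    have e1 : scaleHom w (MvPolynomial.bind₁ S f) = aeval (fun i => scaleHom w (S i)) f :=
      comp_aeval_apply S (scaleHom w) f
    have e2 : (fun i => scaleHom w (S i)) = ![Polynomial.C (S 0) * Polynomial.X ^ a,
        Polynomial.C (S 1) * Polynomial.X ^ a, Polynomial.C (S 2) * Polynomial.X ^ b,
        Polynomial.C (S 3) * Polynomial.X ^ b] := by
      ext1 i
      fin_cases i
      exacts [h0, h1, h2, h3]
    have e3 : aeval (fun i => Polynomial.C (S i)) f = Polynomial.C (MvPolynomial.bind₁ S f) :=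
      (comp_aeval_apply S (Polynomial.CAlgHom (R := ℂ)) f).symm
    rw [e1, e2, hf.aeval_mul_pow (fun i => Polynomial.C (S i)), e3, pow_add, pow_mul, pow_mul,
      mul_assoc]
  exact ⟨key _ _ _ hS.1.1 hS.2.1.1 hS.2.2.1.1 hS.2.2.2.1,
    key _ _ _ hS.1.2 hS.2.1.2 hS.2.2.1.2 hS.2.2.2.2⟩

/-- A polynomial on `ℂ` without zeros whose value at infinity, as a form of degree `N`, is
nonzero as well, has `N = 0`. -/
theorem eq_zero_of_eval_inv {f r : Polynomial ℂ} {N : ℕ} (hf : ∀ s, f.eval s ≠ 0)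
    (hr : ∀ s, s ≠ 0 → r.eval s = f.eval s⁻¹ * s ^ N) (hr0 : r.eval 0 ≠ 0) : N = 0 := by
  -- `f` is a constant `a`, hence `r = a * X ^ N`
  have hdeg : f.degree = 0 := by
    by_contra h
    obtain ⟨s, hs⟩ := IsAlgClosed.exists_root f h
    exact hf s hs
  rw [Polynomial.eq_C_of_degree_eq_zero hdeg] at hr
  have : Polynomial.X * (r - Polynomial.C (f.coeff 0) * Polynomial.X ^ N) = 0 := by
    refine Polynomial.funext fun s => ?_
    by_cases hs : s = 0
    · simp [hs]
    · simp [hr s hs]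
  have hrr := (mul_eq_zero.mp this).resolve_left Polynomial.X_ne_zero
  by_contra hN
  apply hr0
  rw [sub_eq_zero.mp hrr]
  simp [hN]

/-- A bihomogeneous polynomial without zeros on `ℙ¹ × ℙ¹` is constant. -/
theorem IsBihom.eq_zero_of_eval_ne_zero {g : MvPolynomial (Fin 4) ℂ} {m n : ℕ}
    (hg : IsBihom g m n) (h : ∀ u, IsBiproj u → eval u g ≠ 0) : m = 0 ∧ n = 0 := by
  have hev (v : Fin 4 → Polynomial ℂ) (s : ℂ) :
      (aeval v g).eval s = eval (fun i => (v i).eval s) g := by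
    have : (Polynomial.aeval s).comp (aeval v : MvPolynomial (Fin 4) ℂ →ₐ[ℂ] Polynomial ℂ) =
        aeval (fun i => (v i).eval s) := by
      ext1 i
      simp
    exact congr($this g)
  have hsc := hg.aeval_mul_pow (A := ℂ)
  constructor
  · refine eq_zero_of_eval_inv (f := aeval ![1, .X, 1, 0] g) (r := aeval ![.X, 1, 1, 0] g)
      (fun s => ?_) (fun s hs => ?_) ?_
    · rw [hev]
      exact h _ (by simp [IsBiproj])
    · rw [hev, hev]
      have := hsc ![1, s⁻¹, 1, 0] s 1
      simp only [one_pow, mul_one, aeval_eq_eval] at this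
      convert! this using 2
      · congr 2
        ext i
        fin_cases i <;> simp [hs]
      · congr 2
        ext i
        fin_cases i <;> simp
    · rw [hev]
      exact h _ (by simp [IsBiproj])
  · refine eq_zero_of_eval_inv (f := aeval ![1, 0, 1, .X] g) (r := aeval ![1, 0, .X, 1] g)
      (fun s => ?_) (fun s hs => ?_) ?_
    · rw [hev]
      exact h _ (by simp [IsBiproj])
    · rw [hev, hev]
      have := hsc ![1, 0, 1, s⁻¹] 1 s
      simp only [one_pow, mul_one, aeval_eq_eval] at this
      convert! this using 2
      · congr 2
        ext i
        fin_cases i <;> simp [hs]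
      · congr 2
        ext i
        fin_cases i <;> simp
    · rw [hev]
      exact h _ (by simp [IsBiproj])

/-- Polynomials proportional to two distinct variables are multiples of these by the same factor. -/
theorem exists_eq_X_mul {i j : Fin 4} (hij : i ≠ j) {f g : MvPolynomial (Fin 4) ℂ}
    (h : f * X j = g * X i) : ∃ r, f = X i * r ∧ g = X j * r := by
  have hdvd : (X i : MvPolynomial (Fin 4) ℂ) ∣ f := by
    refine ((X_prime (i := i)).dvd_or_dvd (Dvd.intro_left g h.symm)).resolve_right fun hX => ?_
    exact hij (X_dvd_X.mp hX)
  obtain ⟨r, rfl⟩ := hdvd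
  refine ⟨r, rfl, mul_right_cancel₀ (X_ne_zero i) ?_⟩
  rw [← h]
  ring

/-- A self-map of `ℙ¹ × ℙ¹` inducing the identity is given by forms of bidegrees `(1, 0)` and
`(0, 1)`. Here the hypothesis `h` says that `segre (T u)` is proportional to `segre u`. -/
theorem bidegree_of_segre_eq {T : Fin 4 → MvPolynomial (Fin 4) ℂ} {m n m' n' : ℕ}
    (hT : IsBihom (T 0) m n ∧ IsBihom (T 1) m n ∧ IsBihom (T 2) m' n' ∧ IsBihom (T 3) m' n')
    (hb : ∀ u, IsBiproj u → IsBiproj fun i => eval u (T i))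
    (h : ∀ u, IsBiproj u → ∀ i j, segre (fun i => eval u (T i)) i * segre u j =
      segre (fun i => eval u (T i)) j * segre u i) :
    (m = 1 ∧ n = 0) ∧ m' = 0 ∧ n' = 1 := by
  have hpol (i j) : segre T i * segre X j = segre T j * segre X i := by
    rw [← sub_eq_zero]
    refine eq_zero_of_eval_eq_zero one_ne_zero fun u hu _ => ?_
    have := h u hu i j
    have hs (k) : eval u (segre T k) = segre (fun i => eval u (T i)) k := by
      fin_cases k <;> simp [segre]
    have hs' (k) : eval u (segre X k) = segre u k := by
      fin_cases k <;> simp [segre]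
    rw [map_sub, map_mul, map_mul, hs, hs, hs', hs', this, sub_self]
  have h14 := hpol 1 4
  have h32 := hpol 3 2
  have h13 := hpol 1 3
  have h42 := hpol 4 2
  simp only [segre, Matrix.cons_val] at h14 h32 h13 h42
  have hne (u) (hu : IsBiproj u) (i) (hi : T i = 0) : eval u (T i) = 0 := by rw [hi, map_zero]
  have hu₀ : IsBiproj ![1, 0, 1, 0] := by simp [IsBiproj]
  have h01 : T 0 * X 1 = T 1 * X 0 := by
    rcases (hb _ hu₀).2 with hp | hp
    · have : T 2 * X 2 ≠ 0 := mul_ne_zero (fun h => hp (hne _ hu₀ _ h)) (X_ne_zero _)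
      exact mul_left_cancel₀ this (by linear_combination h14)
    · have : T 3 * X 3 ≠ 0 := mul_ne_zero (fun h => hp (hne _ hu₀ _ h)) (X_ne_zero _)
      exact mul_left_cancel₀ this (by linear_combination h32)
  have h23 : T 2 * X 3 = T 3 * X 2 := by
    rcases (hb _ hu₀).1 with hp | hp
    · have : T 0 * X 0 ≠ 0 := mul_ne_zero (fun h => hp (hne _ hu₀ _ h)) (X_ne_zero _)
      exact mul_left_cancel₀ this (by linear_combination h13)
    · have : T 1 * X 1 ≠ 0 := mul_ne_zero (fun h => hp (hne _ hu₀ _ h)) (X_ne_zero _)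
      exact mul_left_cancel₀ this (by linear_combination h42)
  -- the common factor `r` of `T i` and `T j` has no zeros, hence it is constant
  have key (i j : Fin 4) (hij : i ≠ j) (a b c d : ℕ) (hTij : T i * X j = T j * X i)
      (hi : IsBihom (T i) a b) (hX : IsBihom (X i) c d)
      (hbi : ∀ u, IsBiproj u → eval u (T i) ≠ 0 ∨ eval u (T j) ≠ 0) : a = c ∧ b = d := by
    obtain ⟨r, hr, hr'⟩ := exists_eq_X_mul hij hTij
    have hr0 (u) (hu : IsBiproj u) : eval u r ≠ 0 := by
      intro h0
      have := hbi u hu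
      simp [hr, hr', h0] at this
    have hrne : r ≠ 0 := fun h => hr0 _ hu₀ (by rw [h, map_zero])
    have hTne : T i ≠ 0 := by
      rw [hr]
      exact mul_ne_zero (X_ne_zero i) hrne
    obtain ⟨-, f, -, f', -, hrf⟩ := exists_isBihom_of_mul (ι := Unit) (h := X i) (c := fun _ => r)
      (fun _ => by rw [← hr]; exact hi) (k₀ := ()) (by rwa [← hr])
    obtain ⟨rfl, rfl⟩ := (hrf ()).eq_zero_of_eval_ne_zero hr0
    exact hi.inj hTne (by rw [hr]; exact hX.mul (hrf ()))
  exact ⟨key 0 1 (by decide) _ _ _ _ h01 hT.1 (isBihom_X_left (.inl rfl)) fun u hu => (hb u hu).1,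
    key 2 3 (by decide) _ _ _ _ h23 hT.2.2.1 (isBihom_X_right (.inl rfl)) fun u hu => (hb u hu).2⟩

/-- The bidegrees of an automorphism of `ℙ¹ × ℙ¹`: it preserves or exchanges the two rulings.
The bidegrees of the automorphism and of its inverse form two mutually inverse matrices of
natural numbers. -/
theorem bidegree_of_inverse {S S' : Fin 4 → MvPolynomial (Fin 4) ℂ} {m n m' n' k l k' l' : ℕ}
    (hS : IsBihom (S 0) m n ∧ IsBihom (S 1) m n ∧ IsBihom (S 2) m' n' ∧ IsBihom (S 3) m' n')
    (hS' : IsBihom (S' 0) k l ∧ IsBihom (S' 1) k l ∧ IsBihom (S' 2) k' l' ∧ IsBihom (S' 3) k' l')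
    (hb : ∀ u, IsBiproj u → IsBiproj fun i => eval u (S i))
    (hb' : ∀ u, IsBiproj u → IsBiproj fun i => eval u (S' i))
    (h : ∀ u, IsBiproj u → ∀ i j,
      segre (fun i => eval (fun i => eval u (S i)) (S' i)) i * segre u j =
        segre (fun i => eval (fun i => eval u (S i)) (S' i)) j * segre u i) :
    (m = 1 ∧ n = 0 ∧ m' = 0 ∧ n' = 1) ∨ (m = 0 ∧ n = 1 ∧ m' = 1 ∧ n' = 0) := by
  have hev (u : Fin 4 → ℂ) (i : Fin 4) :
      eval u (bind₁ S (S' i)) = eval (fun i => eval u (S i)) (S' i) := by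
    have : ((aeval u).comp (bind₁ S) : MvPolynomial (Fin 4) ℂ →ₐ[ℂ] ℂ) =
        aeval (fun i => eval u (S i)) := by
      ext1 i
      simp [aeval_eq_eval]
    exact congr($this (S' i))
  obtain ⟨⟨h1, h2⟩, h3, h4⟩ := bidegree_of_segre_eq (T := fun i => bind₁ S (S' i))
    ⟨hS'.1.bind₁ hS, hS'.2.1.bind₁ hS, hS'.2.2.1.bind₁ hS, hS'.2.2.2.bind₁ hS⟩
    (fun u hu => by simp_rw [hev]; exact hb' _ (hb u hu))
    (fun u hu => by simp_rw [hev]; exact h u hu)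
  simp only [Nat.add_eq_zero_iff, Nat.mul_eq_zero] at h2 h3
  rcases Nat.add_eq_one_iff.mp h1 with ⟨-, h⟩ | ⟨h, -⟩
  · obtain ⟨rfl, rfl⟩ := mul_eq_one.mp h
    simp only [one_ne_zero, false_or, or_false] at h2 h3
    obtain ⟨-, rfl⟩ := h2
    obtain ⟨h5, rfl⟩ := h3
    simp only [mul_zero, add_zero] at h4
    obtain ⟨rfl, rfl⟩ := mul_eq_one.mp h4
    simp at h5
    simp [h5]
  · obtain ⟨rfl, rfl⟩ := mul_eq_one.mp h
    simp only [one_ne_zero, false_or, or_false] at h2 h3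
    obtain ⟨rfl, -⟩ := h2
    obtain ⟨rfl, h5⟩ := h3
    simp only [mul_zero, zero_add] at h4
    obtain ⟨rfl, rfl⟩ := mul_eq_one.mp h4
    simp at h5
    simp [h5]

/-! ### Linear automorphisms preserving the quadric -/

theorem IsBihom.exists_linear_left {f : MvPolynomial (Fin 4) ℂ} (hf : IsBihom f 1 0) :
    ∃ a : Fin 2 → ℂ, ∀ u, eval u f = a 0 * u 0 + a 1 * u 1 := by
  classical
  refine ⟨![coeff (Finsupp.single 0 1) f, coeff (Finsupp.single 1 1) f], fun u => ?_⟩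
  -- a monomial of bidegree `(1, 0)` is one of the first two variables
  have : f = C (coeff (Finsupp.single 0 1) f) * X 0 + C (coeff (Finsupp.single 1 1) f) * X 1 := by
    ext s
    rw [coeff_add, coeff_C_mul, coeff_C_mul, coeff_X, coeff_X]
    by_cases hs : coeff s f = 0
    · split_ifs with h1 h2 h2
      · rw [← h2] at h1
        simp [Finsupp.single_eq_single_iff] at h1
      · subst h1; simp [hs]
      · subst h2; simp [hs]
      · simp [hs]
    · have e1 := hf.1 hs
      have e2 := hf.2 hs
      simp [Finsupp.weight_apply, Finsupp.sum_fintype, Fin.sum_univ_four] at e1 e2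
      obtain ⟨h0, h1⟩ | ⟨h0, h1⟩ := Nat.add_eq_one_iff.mp e1
      · have hs1 : s = Finsupp.single 1 1 := by
          ext i
          fin_cases i <;> simp [h0, h1, e2]
        subst hs1
        simp [Finsupp.single_eq_single_iff]
      · have hs1 : s = Finsupp.single 0 1 := by
          ext i
          fin_cases i <;> simp [h0, h1, e2]
        subst hs1
        simp [Finsupp.single_eq_single_iff]
  conv_lhs => rw [this]
  simp

theorem IsBihom.exists_linear_right {f : MvPolynomial (Fin 4) ℂ} (hf : IsBihom f 0 1) :
    ∃ a : Fin 2 → ℂ, ∀ u, eval u f = a 0 * u 2 + a 1 * u 3 := by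
  -- exchange the two factors of `ℙ¹ × ℙ¹`
  have hX : IsBihom (X 2) 0 1 ∧ IsBihom (X 3) 0 1 ∧ IsBihom (X 0) 1 0 ∧ IsBihom (X 1) 1 0 :=
    ⟨isBihom_X_right (.inl rfl), isBihom_X_right (.inr rfl), isBihom_X_left (.inl rfl),
      isBihom_X_left (.inr rfl)⟩
  have h := hf.bind₁ (S := ![X 2, X 3, X 0, X 1]) hX
  obtain ⟨a, ha⟩ := h.exists_linear_left
  refine ⟨a, fun u => ?_⟩
  have := ha ![u 2, u 3, u 0, u 1]
  simp only [Matrix.cons_val] at this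
  rw [← this]
  have h2 : ((aeval ![u 2, u 3, u 0, u 1]).comp (MvPolynomial.bind₁ ![X 2, X 3, X 0, X 1]) :
      MvPolynomial (Fin 4) ℂ →ₐ[ℂ] ℂ) = aeval u := by
    ext1 i
    fin_cases i <;> simp
  exact congr($h2 f).symm

/-- Write `[[x, z], [w, y]]` for the matrix `M` formed by the coordinates other than `u` of a
vector in `ℂ⁵`. This is the linear map `M ↦ G M Hᵀ` that fixes `u`. -/
def segreLinear (G H : Matrix (Fin 2) (Fin 2) ℂ) : (Fin 5 → ℂ) →ₗ[ℂ] (Fin 5 → ℂ) where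
  toFun v :=
    let e (i j : Fin 2) := G i 0 * H j 0 * v 1 + G i 1 * H j 1 * v 2 + G i 0 * H j 1 * v 3 +
      G i 1 * H j 0 * v 4
    ![v 0, e 0 0, e 1 1, e 0 1, e 1 0]
  map_add' v w := by
    ext i
    fin_cases i <;> simp <;> ring
  map_smul' c v := by
    ext i
    fin_cases i <;> simp <;> ring

theorem segreLinear_adjugate {G H : Matrix (Fin 2) (Fin 2) ℂ} (h : G.det * H.det = 1) :
    segreLinear G.adjugate H.adjugate ∘ₗ segreLinear G H = LinearMap.id := by
  refine LinearMap.ext fun v => ?_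
  rw [Matrix.det_fin_two, Matrix.det_fin_two] at h
  ext i
  fin_cases i
  · rfl
  · simp [segreLinear, Matrix.adjugate_fin_two]
    linear_combination v 1 * h
  · simp [segreLinear, Matrix.adjugate_fin_two]
    linear_combination v 2 * h
  · simp [segreLinear, Matrix.adjugate_fin_two]
    linear_combination v 3 * h
  · simp [segreLinear, Matrix.adjugate_fin_two]
    linear_combination v 4 * h

/-- The automorphism `segreLinear G H`, for `det G * det H = 1`. -/
def segreLinearEquiv (G H : Matrix (Fin 2) (Fin 2) ℂ) (h : G.det * H.det = 1) :
    (Fin 5 → ℂ) ≃ₗ[ℂ] (Fin 5 → ℂ) :=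
  LinearEquiv.ofLinearMap (segreLinear G H) (segreLinear G.adjugate H.adjugate)
    (by
      have hdet (A : Matrix (Fin 2) (Fin 2) ℂ) : A.adjugate.det = A.det := by
        simp [Matrix.det_adjugate]
      have hadj (A : Matrix (Fin 2) (Fin 2) ℂ) : A.adjugate.adjugate = A := by
        simp [Matrix.adjugate_adjugate]
      have := segreLinear_adjugate (G := G.adjugate) (H := H.adjugate)
        (by rwa [hdet, hdet])
      rwa [hadj, hadj] at this)
    (segreLinear_adjugate h)

theorem eval_quadric (v : Fin 5 → ℂ) : eval v quadric = v 0 ^ 2 + v 1 * v 2 - v 3 * v 4 := by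
  simp [quadric]

/-- On the coordinates other than `u` the quadratic form is the determinant of `M`. -/
theorem eval_quadric_segreLinear {G H : Matrix (Fin 2) (Fin 2) ℂ} (h : G.det * H.det = 1)
    (v : Fin 5 → ℂ) : eval (segreLinear G H v) quadric = eval v quadric := by
  rw [Matrix.det_fin_two, Matrix.det_fin_two] at h
  rw [eval_quadric, eval_quadric]
  simp [segreLinear]
  linear_combination (v 1 * v 2 - v 3 * v 4) * h

/-- The action of a pair of `2 × 2` matrices on the homogeneous coordinates of a pair of points of
`ℙ¹`. -/
def pairLinear (G H : Matrix (Fin 2) (Fin 2) ℂ) (u : Fin 4 → ℂ) : Fin 4 → ℂ :=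
  ![G 0 0 * u 0 + G 0 1 * u 1, G 1 0 * u 0 + G 1 1 * u 1,
    H 0 0 * u 2 + H 0 1 * u 3, H 1 0 * u 2 + H 1 1 * u 3]

theorem segreLinear_segre (G H : Matrix (Fin 2) (Fin 2) ℂ) (u : Fin 4 → ℂ) :
    segreLinear G H (segre u) = segre (pairLinear G H u) := by
  ext i
  fin_cases i <;> simp [segreLinear, segre, pairLinear] <;> ring

theorem segre_pairLinear_mul (G H : Matrix (Fin 2) (Fin 2) ℂ) (c : ℂ) (u : Fin 4 → ℂ) :
    segre (pairLinear G (c • H) u) = c • segre (pairLinear G H u) := by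
  ext i
  fin_cases i <;> simp [segre, pairLinear] <;> ring

theorem exists_kernel_of_det_eq_zero {G : Matrix (Fin 2) (Fin 2) ℂ} (h : G.det = 0) :
    ∃ s t : ℂ, (s ≠ 0 ∨ t ≠ 0) ∧ ∀ i, G i 0 * s + G i 1 * t = 0 := by
  obtain ⟨v, hv, hGv⟩ := Matrix.exists_mulVec_eq_zero_iff.mpr h
  refine ⟨v 0, v 1, ?_, fun i => ?_⟩
  · by_contra! h0
    exact hv (funext (Fin.forall_fin_two.mpr h0))
  · have := congrFun hGv i
    rwa [Matrix.mulVec_eq_sum, Fin.sum_univ_two, Pi.add_apply, Pi.smul_apply, Pi.smul_apply,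
      Matrix.transpose_apply, Matrix.transpose_apply, op_smul_eq_mul, op_smul_eq_mul] at this

/-- Two invertible linear maps on the two factors of `ℙ¹ × ℙ¹` come from a linear automorphism of
`ℂ⁵` preserving the equation of the quadric threefold. -/
theorem exists_linearEquiv {G H : Matrix (Fin 2) (Fin 2) ℂ}
    (hb : ∀ u : Fin 4 → ℂ, IsBiproj u → IsBiproj (pairLinear G H u)) :
    ∃ (L : (Fin 5 → ℂ) ≃ₗ[ℂ] (Fin 5 → ℂ)) (c : ℂ), c ≠ 0 ∧
      (∀ v, eval (L v) quadric = eval v quadric) ∧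
      ∀ u : Fin 4 → ℂ, L (segre u) = c • segre (pairLinear G H u) := by
  have hG : G.det ≠ 0 := by
    intro h
    obtain ⟨s, t, hst, hG⟩ := exists_kernel_of_det_eq_zero h
    have := (hb ![s, t, 1, 1] ⟨hst, by simp⟩).1
    simp only [pairLinear, Matrix.cons_val, hG, ne_eq, not_true_eq_false, or_self] at this
  have hH : H.det ≠ 0 := by
    intro h
    obtain ⟨s, t, hst, hH⟩ := exists_kernel_of_det_eq_zero h
    have := (hb ![1, 1, s, t] ⟨by simp, hst⟩).2
    simp only [pairLinear, Matrix.cons_val, hH, ne_eq, not_true_eq_false, or_self] at this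
  -- the choice of `c` normalizes the product of the determinants to `1`
  obtain ⟨c, hc⟩ := IsAlgClosed.exists_pow_nat_eq (G.det * H.det)⁻¹ two_pos
  have hc0 : c ≠ 0 := by
    rintro rfl
    rw [zero_pow two_ne_zero] at hc
    exact inv_ne_zero (mul_ne_zero hG hH) hc.symm
  have hdet : G.det * (c • H).det = 1 := by
    rw [Matrix.det_smul, Fintype.card_fin, hc]
    field_simp
  have hL (v) : segreLinearEquiv G _ hdet v = segreLinear G (c • H) v := rfl
  refine ⟨segreLinearEquiv G _ hdet, c, hc0, fun v => ?_, fun u => ?_⟩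
  · rw [hL, eval_quadric_segreLinear hdet]
  · rw [hL, segreLinear_segre, segre_pairLinear_mul]

/-- The exchange of the coordinates `z` and `w`, which on the quadric surface is the exchange of the
two rulings. -/
def swapZW : (Fin 5 → ℂ) ≃ₗ[ℂ] (Fin 5 → ℂ) := LinearEquiv.funCongrLeft ℂ ℂ (Equiv.swap 3 4)

theorem swapZW_apply (v : Fin 5 → ℂ) : swapZW v = ![v 0, v 1, v 2, v 4, v 3] := by
  ext i
  change v (Equiv.swap 3 4 i) = _
  fin_cases i <;> rfl

/-- A self-map of `ℙ¹ × ℙ¹` with the bidegrees of an automorphism is the restriction of a linear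
automorphism of `ℂ⁵` preserving the equation of the quadric threefold. -/
theorem exists_linearEquiv_of_bidegree {S : Fin 4 → MvPolynomial (Fin 4) ℂ} {m n m' n' : ℕ}
    (hS : IsBihom (S 0) m n ∧ IsBihom (S 1) m n ∧ IsBihom (S 2) m' n' ∧ IsBihom (S 3) m' n')
    (hb : ∀ u, IsBiproj u → IsBiproj fun i => eval u (S i))
    (h : (m = 1 ∧ n = 0 ∧ m' = 0 ∧ n' = 1) ∨ (m = 0 ∧ n = 1 ∧ m' = 1 ∧ n' = 0)) :
    ∃ (L : (Fin 5 → ℂ) ≃ₗ[ℂ] (Fin 5 → ℂ)) (c : ℂ), c ≠ 0 ∧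
      (∀ v, eval (L v) quadric = eval v quadric) ∧
      ∀ u, L (segre u) = c • segre fun i => eval u (S i) := by
  obtain ⟨rfl, rfl, rfl, rfl⟩ | ⟨rfl, rfl, rfl, rfl⟩ := h
  · obtain ⟨a, ha⟩ := hS.1.exists_linear_left
    obtain ⟨b, hb'⟩ := hS.2.1.exists_linear_left
    obtain ⟨p, hp⟩ := hS.2.2.1.exists_linear_right
    obtain ⟨q, hq⟩ := hS.2.2.2.exists_linear_right
    have hSu (u : Fin 4 → ℂ) : (fun i => eval u (S i)) = pairLinear ![a, b] ![p, q] u := by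
      ext i
      fin_cases i <;> simp [pairLinear, ha, hb', hp, hq]
    simp_rw [hSu] at hb ⊢
    exact exists_linearEquiv (G := ![a, b]) (H := ![p, q]) hb
  · obtain ⟨a, ha⟩ := hS.1.exists_linear_right
    obtain ⟨b, hb'⟩ := hS.2.1.exists_linear_right
    obtain ⟨p, hp⟩ := hS.2.2.1.exists_linear_left
    obtain ⟨q, hq⟩ := hS.2.2.2.exists_linear_left
    have hSu (u : Fin 4 → ℂ) : (fun i => eval u (S i)) =
        pairLinear ![a, b] ![p, q] ![u 2, u 3, u 0, u 1] := by
      ext i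
      fin_cases i <;> simp [pairLinear, ha, hb', hp, hq]
    simp_rw [hSu] at hb ⊢
    obtain ⟨L, c, hc, hLq, hL⟩ := exists_linearEquiv (G := ![a, b]) (H := ![p, q])
      fun u hu => hb ![u 2, u 3, u 0, u 1] ⟨hu.2, hu.1⟩
    refine ⟨swapZW.trans L, c, hc, fun v => ?_, fun u => ?_⟩
    · rw [LinearEquiv.trans_apply, hLq, swapZW_apply, eval_quadric, eval_quadric]
      simp
      ring
    · have : swapZW (segre u) = segre ![u 2, u 3, u 0, u 1] := by
        rw [swapZW_apply]
        simp [segre, mul_comm]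
      rw [LinearEquiv.trans_apply, this, hL]

/-! ### Extension of automorphisms from the quadric surface to the threefold -/

/-- The Segre map is surjective onto the quadric surface. -/
theorem exists_segre_eq {v : Fin 5 → ℂ} (h0 : v 0 = 0) (h : v 1 * v 2 = v 3 * v 4) :
    ∃ u, segre u = v := by
  obtain ⟨a, b, p, q, h1, h2, h3, h4⟩ := exists_factor_of_mul_eq_mul h
  refine ⟨![a, b, p, q], ?_⟩
  ext i
  fin_cases i <;> simp [segre, *]

theorem isHomogeneous_quadric : quadric.IsHomogeneous 2 :=
  (((isHomogeneous_X ℂ _).pow 2).add ((isHomogeneous_X ℂ _).mul (isHomogeneous_X ℂ _))).sub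
    ((isHomogeneous_X ℂ _).mul (isHomogeneous_X ℂ _))

/-- The inclusion of the quadric surface in `ℙ⁴`. -/
abbrev surfaceι : (projVariety 4 {X 0, quadric}).left ⟶ Proj (grading 4) :=
  projι 4 {X 0, quadric}

theorem exists_surfaceι_eq_pt_iff {v : Fin 5 → ℂ} (hv : v ≠ 0) :
    (∃ z, surfaceι z = pt v hv) ↔ v 0 = 0 ∧ v 1 * v 2 = v 3 * v 4 := by
  rw [exists_projι_eq_pt_iff]
  · simp only [Set.mem_insert_iff, Set.mem_singleton_iff, forall_eq_or_imp, forall_eq, eval_X]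
    refine and_congr_right fun h => ?_
    rw [eval_quadric, h, sub_eq_zero]
    simp
  · rintro f (rfl | rfl)
    exacts [⟨1, isHomogeneous_X ℂ _⟩, ⟨2, isHomogeneous_quadric⟩]

/-- The vector `w` represents the image, under the automorphism `χ` of the quadric surface, of the
point with Segre coordinates `u`. -/
def Represents (χ : projVariety 4 {X 0, quadric} ≅ projVariety 4 {X 0, quadric})
    (u : Fin 4 → ℂ) (w : Fin 5 → ℂ) : Prop :=
  ∃ z hu hw, surfaceι z = pt (segre u) hu ∧ surfaceι (χ.hom.left z) = pt w hw

theorem Represents.eq_pt {χ : projVariety 4 {X 0, quadric} ≅ projVariety 4 {X 0, quadric}}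
    {u : Fin 4 → ℂ} {w : Fin 5 → ℂ} (h : Represents χ u w) {z : (projVariety 4 {X 0, quadric}).left}
    {hu : segre u ≠ 0} (hz : surfaceι z = pt (segre u) hu) :
    ∃ hw, surfaceι (χ.hom.left z) = pt w hw := by
  obtain ⟨z', _, hw, h1, h2⟩ := h
  have : z' = z := surfaceι.isClosedEmbedding.injective (h1.trans hz.symm)
  exact ⟨hw, this ▸ h2⟩

theorem exists_surfaceι_eq_segre {u : Fin 4 → ℂ} (hu : segre u ≠ 0) :
    ∃ z, surfaceι z = pt (segre u) hu := by
  rw [exists_surfaceι_eq_pt_iff]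
  simp only [segre, Matrix.cons_val]
  exact ⟨trivial, by ring⟩

theorem left_surfaceι_structP (χ : projVariety 4 {X 0, quadric} ≅ projVariety 4 {X 0, quadric}) :
    (χ.hom.left ≫ surfaceι) ≫ structP 4 = surfaceι ≫ structP 4 := by
  rw [Category.assoc, projι_structP]
  exact Over.w χ.hom

/-- An automorphism of the quadric surface is given by two pairs of bihomogeneous polynomials in the
Segre coordinates. -/
theorem exists_bihomogeneous_formula
    (χ : projVariety 4 {X 0, quadric} ≅ projVariety 4 {X 0, quadric}) :
    ∃ (S : Fin 4 → MvPolynomial (Fin 4) ℂ) (m n m' n' : ℕ),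
      (IsBihom (S 0) m n ∧ IsBihom (S 1) m n ∧ IsBihom (S 2) m' n' ∧ IsBihom (S 3) m' n') ∧
      ∀ u, IsBiproj u → Represents χ u (segre fun i => eval u (S i)) := by
  apply exists_global_formula
  · intro u w w' h h'
    obtain ⟨z, hu, hw, h1, h2⟩ := h
    obtain ⟨hw', h2'⟩ := h'.eq_pt h1
    exact (pt_eq_pt_iff hw hw').mp (h2.symm.trans h2')
  · rintro u w ⟨z, hu, hw, h1, h2⟩
    exact (exists_surfaceι_eq_pt_iff hw).mp ⟨_, h2⟩
  · rintro u w c hc ⟨z, hu, hw, h1, h2⟩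
    exact ⟨z, hu, smul_ne_zero hc hw, h1, h2.trans (pt_smul hw _).symm⟩
  · intro x hx
    have hx' := segre_ne_zero_iff.mpr hx
    obtain ⟨z, hz⟩ := exists_surfaceι_eq_segre hx'
    obtain ⟨d, A, j, hA, hj, hloc⟩ := exists_local_formula surfaceι (χ.hom.left ≫ surfaceι)
      (left_surfaceι_structP χ) hx' hz
    refine ⟨d, A, j, hA, hj, fun u hu huj => ?_⟩
    have hu' := segre_ne_zero_iff.mpr hu
    obtain ⟨z', hz'⟩ := exists_surfaceι_eq_segre hu'
    obtain ⟨hw, h⟩ := hloc z' _ hu' hz' huj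
    exact ⟨z', hu', hw, hz', h⟩

/-- Every automorphism of the quadric surface is induced by a linear automorphism of `ℂ⁵` that
preserves the equation of the quadric threefold. -/
theorem exists_linearEquiv_of_iso
    (χ : projVariety 4 {X 0, quadric} ≅ projVariety 4 {X 0, quadric}) :
    ∃ L : (Fin 5 → ℂ) ≃ₗ[ℂ] (Fin 5 → ℂ), (∀ v, eval (L v) quadric = eval v quadric) ∧
      χ.hom.left ≫ surfaceι = surfaceι ≫ projMap L := by
  obtain ⟨S, m, n, m', n', hS, hR⟩ := exists_bihomogeneous_formula χ
  obtain ⟨S', k, l, k', l', hS', hR'⟩ := exists_bihomogeneous_formula χ.symm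
  have hb (u) (hu : IsBiproj u) : IsBiproj fun i => eval u (S i) := by
    obtain ⟨_, _, hw, _⟩ := hR u hu
    exact segre_ne_zero_iff.mp hw
  have hb' (u) (hu : IsBiproj u) : IsBiproj fun i => eval u (S' i) := by
    obtain ⟨_, _, hw, _⟩ := hR' u hu
    exact segre_ne_zero_iff.mp hw
  have hdeg := bidegree_of_inverse hS hS' hb hb' fun u hu => by
    obtain ⟨z, hu', hw, h1, h2⟩ := hR u hu
    obtain ⟨hw', h3⟩ := (hR' _ (hb u hu)).eq_pt h2
    have h4 : χ.symm.hom.left (χ.hom.left z) = z := by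
      have : χ.hom.left ≫ χ.symm.hom.left = 𝟙 _ := by
        rw [← Over.comp_left, Iso.symm_hom, Iso.hom_inv_id, Over.id_left]
      exact congr($this z)
    rw [h4] at h3
    exact (pt_eq_pt_iff hw' hu').mp (h3.symm.trans h1)
  obtain ⟨L, c, hc, hLq, hL⟩ := exists_linearEquiv_of_bidegree hS hb hdeg
  refine ⟨L, hLq, hom_ext_pt (left_surfaceι_structP χ) ?_ fun z v hv hz => ?_⟩
  · rw [Category.assoc, projMap_structP]
  · obtain ⟨h0, h1⟩ := (exists_surfaceι_eq_pt_iff hv).mp ⟨z, hz⟩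
    obtain ⟨u, rfl⟩ := exists_segre_eq h0 h1
    obtain ⟨hw, h2⟩ := (hR u (segre_ne_zero_iff.mp hv)).eq_pt hz
    refine Eq.trans h2 (Eq.trans ?_ (congr(projMap L $hz).trans (projMap_pt L hv)).symm)
    rw [pt_eq_pt_iff]
    intro i j
    rw [hL]
    simp only [Pi.smul_apply, smul_eq_mul]
    ring

theorem projInclusion_projι {n : ℕ} {s t : Set (MvPolynomial (Fin (n + 1)) ℂ)} (h : s ⊆ t) :
    (projInclusion n h).left ≫ projι n s = projι n t :=
  Scheme.IdealSheafData.inclusion_subschemeι _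

/-- The automorphism and its extension are both induced by the same linear automorphism of `ℂ⁵`. -/
theorem exists_comp_projInclusion_eq
    (χ : projVariety 4 {X 0, quadric} ≅ projVariety 4 {X 0, quadric})
    (h : ({quadric} : Set (MvPolynomial (Fin (4 + 1)) ℂ)) ⊆ {X 0, quadric}) :
    ∃ Φ : projVariety 4 {quadric} ≅ projVariety 4 {quadric},
      χ.hom ≫ projInclusion 4 h = projInclusion 4 h ≫ Φ.hom := by
  obtain ⟨L, hLq, hL⟩ := exists_linearEquiv_of_iso χ
  obtain ⟨Φ, hΦ⟩ := exists_projVariety_iso (s := {quadric}) L (by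
    rintro f rfl
    exact hLq)
  refine ⟨Φ, Over.OverMorphism.ext ?_⟩
  rw [← cancel_mono (projι 4 {quadric}), Over.comp_left, Over.comp_left, Category.assoc,
    Category.assoc, hΦ, projInclusion_projι, ← Category.assoc, projInclusion_projι, hL]

/-- Every automorphism of `D` extends to an automorphism of `Y₁`. -/
theorem exists_extension (χ : D ≅ D) : ∃ Φ : Y₁ ≅ Y₁, χ.hom ≫ inclD = inclD ≫ Φ.hom :=
  exists_comp_projInclusion_eq χ (by simp)

/-- Pushouts along `i` and along `χ ≫ i` are isomorphic if the automorphism `χ` of the common source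
extends along the other leg `j`. -/
theorem _root_.CategoryTheory.IsPushout.nonempty_iso {C : Type*} [Category C] {Z A B X X' : C}
    {i i' : Z ⟶ A} {j : Z ⟶ B} {a : A ⟶ X} {b : B ⟶ X} {a' : A ⟶ X'} {b' : B ⟶ X'}
    (h : IsPushout i j a b) (h' : IsPushout i' j a' b') (χ : Z ≅ Z) (Φ : B ≅ B)
    (hi : i = χ.hom ≫ i') (hj : χ.hom ≫ j = j ≫ Φ.hom) : Nonempty (X ≅ X') := by
  have : IsPushout i j a' (Φ.hom ≫ b') :=
    h'.of_iso χ.symm (Iso.refl _) Φ.symm (Iso.refl _) (by simp [hi]) (by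
      rw [Iso.symm_hom, Iso.symm_hom, Iso.eq_inv_comp, ← Category.assoc, hj]
      simp) (by simp) (by simp)
  exact ⟨h.isoIsPushout _ _ this⟩

end ConifoldGluing

end

open ConifoldGluing in
theorem lemma1p3
    (Y Y₀ : CScheme) (p : Y.left) (hY : IsConifold Y p)
    (π : Y₀ ⟶ Y) (hπ : IsBlowup π.left (pointIdeal p))
    (e : D ≅ exceptional π p)
    (φ ψ : D ≅ D) (X X' : CScheme)
    (hX : IsGluing (φ.hom ≫ e.hom ≫ inclE π p) inclD X)
    (hX' : IsGluing (ψ.hom ≫ e.hom ≫ inclE π p) inclD X') :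
    Nonempty (X ≅ X') := by
  obtain ⟨a, b, h⟩ := hX
  obtain ⟨a', b', h'⟩ := hX'
  obtain ⟨Φ, hΦ⟩ := exists_extension (φ ≪≫ ψ.symm)
  exact h.nonempty_iso h' (φ ≪≫ ψ.symm) Φ (by simp) hΦ
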